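/- Let $H\in(0,1)$ and let $J_{1-H}$ be the Bessel function of the first kind of index $1-H$. Let $\cdots<\omega_{-1}<\omega_0:=0<\omega_1<\cdots$ be the ordered real zeros of $J_{1-H}$. Put $c_H:=\sin(\pi H)\Gamma(2H+1)$ and, for $k\in\mathbb{Z}$, with $\delta_{k,0}$ the Kronecker delta, $$c_H'=c_{H,k}':=\frac{\Gamma(3/2-H)\sqrt{c_H}}{1+(\sqrt{2-2H}-1)\delta_{k,0}},$$ $$\phi_k(2\lambda):=\sqrt{\frac{\pi}{c_H}}\,2^{H-1}\bigl(1+(\sqrt{2-2H}-1)\delta_{k,0}\bigr)e^{i(\omega_k-\lambda)}\frac{\lambda^HJ_{1-H}(\lambda)}{\lambda-\omega_k}\qquad(\lambda\in\mathbb{R},\ \lambda\ne\omega_k),$$ $$\phi_k(2\omega_k):=\lim_{\lambda\to2\omega_k}\phi_k(\lambda),\qquad a_k:=\frac1{\phi_k(2\omega_k)},$$ where $\lambda^HJ_{1-H}(\lambda)$ is understood for $\lambda<0$ as the odd real entire function that it defines for $\lambda>0$. Let $$g_k(s):=\mathbb{1}_{(0,1)}(s)\,\partial_s\int_0^s e^{2i\omega_k(s-u)}(u-u^2)^{1/2-H}\,du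 .$$ Then the sequences $(e^{2i\omega_k\cdot})_{k\in\mathbb{Z}}$ and $(a_ke^{i\omega_k}g_k/c_H')_{k\in\mathbb{Z}}$ are biorthogonal Riesz bases of the complex Hilbert space $L^2[0,1]$; that is, both consist of elements of $L^2[0,1]$, each is the image of an orthonormal basis under a bounded invertible linear operator on $L^2[0,1]$, and for all $k,\ell\in\mathbb{Z}$ $$\bigl\langle e^{2i\omega_k\cdot},\,a_\ell e^{i\omega_\ell}g_\ell/c_{H,\ell}'\bigr\rangle_{L^2[0,1]}=\delta_{k,\ell}.$$ -/

import Mathlib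

open MeasureTheory Filter Topology

noncomputable section

/-- A Riesz basis of a Hilbert space: the image of an orthonormal basis under a bounded
invertible operator. -/
def IsRieszBasis {ι E : Type*} [NormedAddCommGroup E] [InnerProductSpace ℂ E]
    (v : ι → E) : Prop :=
  ∃ (b : HilbertBasis ι ℂ E) (T : E ≃L[ℂ] E), ∀ i, v i = T (b i)

/-- Biorthogonality of two families: `⟪v i, w j⟫ = δ i j`. -/
def IsBiorthogonal {ι E : Type*} [DecidableEq ι] [NormedAddCommGroup E] [InnerProductSpace ℂ E]
    (v w : ι → E) : Prop :=
  ∀ i j, inner ℂ (v i) (w j) = if i = j then (1 : ℂ) else 0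

/-- The Bessel function of the first kind `J_ν(z)`, with the principal branch of `(z / 2) ^ ν`. -/
def besselJ (ν z : ℂ) : ℂ :=
  (z / 2) ^ ν * ∑' m : ℕ,
    (-1) ^ m / ((m.factorial : ℂ) * Complex.Gamma (m + ν + 1)) * (z / 2) ^ (2 * m)

/-- `ω` lists all the real zeros of `J_ν` in increasing order, with `ω 0 = 0`. -/
def IsOrderedZeros (ν : ℝ) (ω : ℤ → ℝ) : Prop :=
  StrictMono ω ∧ ω 0 = 0 ∧ Set.range ω = {x : ℝ | besselJ ν x = 0}

/-- `… < ω₋₁ < ω₀ = 0 < ω₁ < …`, the ordered real zeros of `J_{1-H}`. There is at most one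
such enumeration. -/
def besselZero (H : ℝ) : ℤ → ℝ :=
  Classical.epsilon (IsOrderedZeros (1 - H))

/-- `c_H = sin(πH) Γ(2H+1)`. -/
def cH (H : ℝ) : ℝ := Real.sin (Real.pi * H) * Real.Gamma (2 * H + 1)

/-- The factor `1 + (√(2-2H) - 1) δ_{k,0}`. -/
def zeroFactor (H : ℝ) (k : ℤ) : ℝ :=
  1 + (Real.sqrt (2 - 2 * H) - 1) * (if k = 0 then 1 else 0)

/-- `c'_H = Γ(3/2-H) √c_H / (1 + (√(2-2H) - 1) δ_{k,0})`, which depends on `k` only through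
`k = 0` or `k ≠ 0`. -/
def cH' (H : ℝ) (k : ℤ) : ℝ :=
  Real.Gamma (3 / 2 - H) * Real.sqrt (cH H) / zeroFactor H k

/-- The value at `2 * x` of `φ_k`, for `x ≠ ω_k`. For `x < 0` the product of the two principal
branches `x ^ H` and `J_{1-H}(x)` is the value at `x` of the odd real entire function that agrees
with it for `x > 0`. -/
def phiOff (H : ℝ) (k : ℤ) (x : ℝ) : ℂ :=
  ((Real.sqrt (Real.pi / cH H) * (2 : ℝ) ^ (H - 1) * zeroFactor H k : ℝ) : ℂ) *
    Complex.exp (Complex.I * ((besselZero H k - x : ℝ) : ℂ)) *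
    ((x : ℂ) ^ (H : ℂ) * besselJ (1 - H) x / ((x - besselZero H k : ℝ) : ℂ))

/-- The function `φ_k`, extended to `2 ω_k` by its limit. -/
def phi (H : ℝ) (k : ℤ) (y : ℝ) : ℂ :=
  if y = 2 * besselZero H k then
    limUnder (𝓝[≠] (2 * besselZero H k)) (fun z : ℝ => phiOff H k (z / 2))
  else phiOff H k (y / 2)

/-- `a_k`, given by `a_k⁻¹ = φ_k(2 ω_k)`. -/
def aCoeff (H : ℝ) (k : ℤ) : ℂ := (phi H k (2 * besselZero H k))⁻¹

/-- `f_k(t) = e^{2 i ω_k t}`. -/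
def fFun (H : ℝ) (k : ℤ) (t : ℝ) : ℂ :=
  Complex.exp (2 * Complex.I * (besselZero H k : ℂ) * (t : ℂ))

/-- `g_k(s) = 𝟙_{(0,1)}(s) ∂_s ∫_0^s e^{2 i ω_k (s-u)} (u-u²)^{1/2-H} du`. -/
def gFun (H : ℝ) (k : ℤ) : ℝ → ℂ :=
  (Set.Ioo (0 : ℝ) 1).indicator (deriv fun s : ℝ =>
    ∫ u in (0 : ℝ)..s, Complex.exp (2 * Complex.I * (besselZero H k : ℂ) * ((s - u : ℝ) : ℂ)) *
      (((u - u ^ 2) ^ (1 / 2 - H) : ℝ) : ℂ))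

/-- `a_k e^{i ω_k} g_k / c'_H`. -/
def dualFun (H : ℝ) (k : ℤ) (s : ℝ) : ℂ :=
  aCoeff H k * Complex.exp (Complex.I * (besselZero H k : ℂ)) * gFun H k s / (cH' H k : ℂ)

end

/-! Put `a = 1/2 - H`, so that `|a| < 1/2`. Poisson's integral writes `J_{1-H}(x)` as a constant
times `x^(1-H)` times the cosine transform of the weight `w(u) = (u - u²)^a` on `[0,1]`, so the real
zeros are those of `x * cosTransform a x`. For `x > 0`, rotating the path of integration turns the
transform into an integral of positive multiples of `sin (x - aβ)` with `0 < β < π/2`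
(`mul_cosTransform_pos`). Its sign is therefore known outside the `D`-neighbourhoods of the
multiples of `π`, for any `D > |a|π/2`. Since `|a|π/2 < π/4`, one may take `D < π/4`, and Kadec's
1/4-theorem (`isRieszBasis_exp_of_abs_sub_le`) applies to every choice of one frequency per
neighbourhood.

Let `ω` be a zero, `g` the derivative of the convolution of `w` with `e^{2iωs}`, and write hats for
Fourier transforms at frequency `2l`. Integration by parts (`sub_mul_dualFourier`) gives `(l - ω)
ĝ(l) = l ŵ(l)`, so `ĝ` vanishes at every other zero. It cannot vanish along a whole Kadec sequence,
since completeness would force `g = 0`. Hence each neighbourhood contains exactly one zero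
(`zero_unique_near`), the zeros are indexed by `ℤ` with `ω_k` near `kπ`, and `ĝ_k(ω_k) ≠ 0`.

The same identity shows that `φ_k(2l)` is a constant multiple of `ĝ_k(l)`, so `a_k` is exactly the
normalisation that gives biorthogonality. A family biorthogonal to a Riesz basis is itself a Riesz
basis (`IsRieszBasis.of_isBiorthogonal`). -/

section Abstract

/-! ### Perturbation of orthonormal bases and duality of Riesz bases. -/

variable {ι E : Type*} [NormedAddCommGroup E] [InnerProductSpace ℂ E]

theorem Orthonormal.norm_sum_smul {v : ι → E} (hv : Orthonormal ℂ v) (s : Finset ι) (c : ι → ℂ) :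
    ‖∑ k ∈ s, c k • v k‖ = √(∑ k ∈ s, ‖c k‖ ^ 2) := by
  have h : ‖∑ k ∈ s, c k • v k‖ ^ 2 = ∑ k ∈ s, ‖c k‖ ^ 2 := by
    have h1 := inner_self_eq_norm_sq_to_K (𝕜 := ℂ) (∑ k ∈ s, c k • v k)
    rw [hv.inner_sum] at h1
    simp only [RCLike.conj_mul] at h1
    exact_mod_cast h1.symm
  rw [← h, Real.sqrt_sq (norm_nonneg _)]

/-- If the increments of `φ` are controlled by those of `m`, then applying `φ (τ k)` to the `k`-th
vector of an orthonormal family costs no more than the total increment of `m`. -/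
theorem Orthonormal.norm_sum_increment_le {v : ι → E} (hv : Orthonormal ℂ v)
    {φ : ℝ → E →L[ℂ] E} {m : ℝ → ℝ} {B : ℝ}
    (hφ : ∀ s t, 0 ≤ s → s ≤ t → t ≤ B → ‖φ t - φ s‖ ≤ m t - m s)
    (τ : ι → ℝ) (c : ι → ℂ) (s : Finset ι) :
    ∀ b, 0 ≤ b → b ≤ B → (∀ k ∈ s, b ≤ τ k ∧ τ k ≤ B) →
      ‖∑ k ∈ s, c k • (φ (τ k) - φ b) (v k)‖ ≤ (m B - m b) * √(∑ k ∈ s, ‖c k‖ ^ 2) := by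
  classical
  -- Abel summation in the order of increasing `τ`: the increment from `b` to the smallest `τ a` is
  -- one operator common to all terms, so it acts on the whole orthonormal sum; the other terms
  -- restart from `τ a`.
  induction s using Finset.induction_on_min_value τ with
  | empty => simp
  | insert a s ha hmin ih =>
    intro b hb hbB hs
    have hab := hs a (Finset.mem_insert_self _ _)
    have h1 : ∑ k ∈ insert a s, c k • (φ (τ k) - φ b) (v k) =
        (φ (τ a) - φ b) (∑ k ∈ insert a s, c k • v k) +
          ∑ k ∈ s, c k • (φ (τ k) - φ (τ a)) (v k) := by
      rw [map_sum, Finset.sum_insert ha, Finset.sum_insert ha, add_assoc, ← Finset.sum_add_distrib]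
      congr 1
      · simp
      · refine Finset.sum_congr rfl fun k _ => ?_
        simp only [map_smul, sub_apply, ← smul_add]
        congr 1
        abel
    have h2 := ih (τ a) (hb.trans hab.1) hab.2
      fun k hk => ⟨hmin k hk, (hs k (Finset.mem_insert_of_mem hk)).2⟩
    have h3 : ‖(φ (τ a) - φ b) (∑ k ∈ insert a s, c k • v k)‖ ≤
        (m (τ a) - m b) * √(∑ k ∈ insert a s, ‖c k‖ ^ 2) := by
      rw [← hv.norm_sum_smul]
      exact ContinuousLinearMap.le_of_opNorm_le _ (hφ b (τ a) hb hab.1 hab.2) _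
    have h4 : √(∑ k ∈ s, ‖c k‖ ^ 2) ≤ √(∑ k ∈ insert a s, ‖c k‖ ^ 2) :=
      Real.sqrt_le_sqrt (Finset.sum_le_sum_of_subset_of_nonneg (Finset.subset_insert _ _)
        fun _ _ _ => by positivity)
    have h5 : 0 ≤ m B - m (τ a) :=
      (norm_nonneg _).trans (hφ (τ a) B (hb.trans hab.1) hab.2 le_rfl)
    rw [h1]
    calc _ ≤ _ := norm_add_le _ _
      _ ≤ _ := add_le_add h3 (h2.trans (mul_le_mul_of_nonneg_left h4 h5))
      _ = _ := by ring

/-- The Paley–Wiener perturbation criterion. -/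
theorem HilbertBasis.exists_equiv_of_perturbation [CompleteSpace E] (b : HilbertBasis ι ℂ E)
    (d : ι → E) {ρ : ℝ} (hρ0 : 0 ≤ ρ) (hρ : ρ < 1)
    (hd : ∀ (s : Finset ι) (c : ι → ℂ), ‖∑ k ∈ s, c k • d k‖ ≤ ρ * √(∑ k ∈ s, ‖c k‖ ^ 2)) :
    ∃ T : E ≃L[ℂ] E, ∀ k, T (b k) = b k - d k := by
  have hsum : ∀ x : E, Summable fun k => b.repr x k • d k := by
    intro x
    have h2 : Summable fun k => ‖b.repr x k‖ ^ 2 := by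
      have := (lp.memℓp (b.repr x)).summable (by norm_num)
      simpa using this
    rw [summable_iff_vanishing_norm] at h2 ⊢
    intro ε hε
    obtain ⟨s, hs⟩ := h2 (ε ^ 2) (by positivity)
    refine ⟨s, fun t ht => ?_⟩
    have h3 := hs t ht
    rw [Real.norm_of_nonneg (by positivity)] at h3
    calc _ ≤ _ := hd t _
      _ ≤ 1 * √(∑ k ∈ t, ‖b.repr x k‖ ^ 2) := by gcongr
      _ < ε := by
        rw [one_mul, Real.sqrt_lt' hε]
        exact h3
  -- The operator sending `b k` to `d k`. Its norm is at most `ρ < 1`, so `1 - R` is invertible by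
  -- the Neumann series.
  let R₀ : E →ₗ[ℂ] E :=
    { toFun := fun x => ∑' k, b.repr x k • d k
      map_add' := fun x y => by
        rw [← (hsum x).tsum_add (hsum y)]
        simp [add_smul]
      map_smul' := fun a x => by
        simp only [RingHom.id_apply]
        rw [← (hsum x).tsum_const_smul]
        simp [mul_smul] }
  have hR : ∀ x, ‖R₀ x‖ ≤ ρ * ‖x‖ := by
    intro x
    refine le_of_tendsto (hsum x).hasSum.norm (Eventually.of_forall fun s => ?_)
    refine (hd s _).trans ?_
    gcongr
    rw [← b.repr.norm_map x, Real.sqrt_le_left (norm_nonneg _)]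
    have := lp.sum_rpow_le_norm_rpow (p := 2) (by norm_num) (b.repr x) s
    simpa using this
  let R : E →L[ℂ] E := R₀.mkContinuous ρ hR
  have hRn : ‖R‖ < 1 := (R₀.mkContinuous_norm_le hρ0 hR).trans_lt hρ
  refine ⟨ContinuousLinearEquiv.unitsEquiv ℂ E (Units.oneSub R hRn), fun k => ?_⟩
  have hRk : R (b k) = d k := by
    change ∑' j, b.repr (b k) j • d j = d k
    classical
    rw [tsum_eq_single k]
    · simp [b.repr_self]
    · intro j hj
      simp [b.repr_self, hj]
  simp [hRk]

/-- If `v = T b`, biorthogonality says that `T* (w j)` has the coordinates of `b j`. Hence `w =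
(T*)⁻¹ b`, and `(T*)⁻¹` is bounded and invertible. -/
theorem IsRieszBasis.of_isBiorthogonal [CompleteSpace E] [DecidableEq ι] {v w : ι → E}
    (hv : IsRieszBasis v) (h : IsBiorthogonal v w) : IsRieszBasis w := by
  obtain ⟨b, T, hT⟩ := hv
  let S : E ≃L[ℂ] E := ContinuousLinearEquiv.equivOfInverse
    (ContinuousLinearMap.adjoint (T.symm : E →L[ℂ] E)) (ContinuousLinearMap.adjoint (T : E →L[ℂ] E))
    (fun x => by
      refine ext_inner_left ℂ fun y => ?_
      simp [ContinuousLinearMap.adjoint_inner_right])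
    (fun x => by
      refine ext_inner_left ℂ fun y => ?_
      simp [ContinuousLinearMap.adjoint_inner_right])
  refine ⟨b, S, fun j => ?_⟩
  have h1 : ContinuousLinearMap.adjoint (T : E →L[ℂ] E) (w j) = b j := by
    apply b.repr.injective
    ext i
    have h2 := h i j
    rw [hT] at h2
    rw [b.repr_apply_apply, b.repr_apply_apply, ContinuousLinearMap.adjoint_inner_right,
      orthonormal_iff_ite.mp b.orthonormal]
    exact h2
  rw [← h1]
  exact (S.apply_symm_apply (w j)).symm

/-- A vector orthogonal to all members of a Riesz basis vanishes. -/
theorem IsRieszBasis.eq_zero_of_inner_eq_zero [CompleteSpace E] {v : ι → E}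
    (hv : IsRieszBasis v) {x : E} (h : ∀ i, inner ℂ (v i) x = 0) : x = 0 := by
  obtain ⟨b, T, hT⟩ := hv
  have h1 : ContinuousLinearMap.adjoint (T : E →L[ℂ] E) x = 0 := by
    apply b.repr.injective
    ext i
    simp [b.repr_apply_apply, ContinuousLinearMap.adjoint_inner_right, ← hT, h]
  refine ext_inner_left ℂ fun y => ?_
  have h2 := ContinuousLinearMap.adjoint_inner_right (T : E →L[ℂ] E) (T.symm y) x
  simpa [h1] using h2.symm

end Abstract

/-! ### Kadec's 1/4-theorem through monotone increments of sine and cosine. -/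

section Kadec

/-- The product formula reduces this to `|sin (p x)| ≤ sin p` for `p` equal to half the sum and half
the difference. It is the increment bound required by `Orthonormal.norm_sum_increment_le`, with `m =
-cos`. -/
theorem abs_cos_mul_sub_cos_mul_le {s t x : ℝ} (hs : 0 ≤ s) (hst : s ≤ t) (ht : t ≤ Real.pi / 4)
    (hx : |x| ≤ 1) : |Real.cos (t * x) - Real.cos (s * x)| ≤ Real.cos s - Real.cos t := by
  have hpi := Real.pi_pos
  have key : ∀ p, 0 ≤ p → p ≤ Real.pi / 4 → |Real.sin (p * x)| ≤ Real.sin p := by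
    intro p hp hp'
    have h1 : |p * x| ≤ p := by
      rw [abs_mul, abs_of_nonneg hp]
      exact mul_le_of_le_one_right hp hx
    rw [abs_le] at h1 ⊢
    constructor
    · rw [← Real.sin_neg]
      exact Real.sin_le_sin_of_le_of_le_pi_div_two (by linarith) (by linarith) h1.1
    · exact Real.sin_le_sin_of_le_of_le_pi_div_two (by linarith) (by linarith) h1.2
  have e1 : Real.cos (t * x) - Real.cos (s * x) =
      -2 * Real.sin ((t + s) / 2 * x) * Real.sin ((t - s) / 2 * x) := by
    rw [Real.cos_sub_cos]; ring_nf
  have e2 : Real.cos s - Real.cos t = 2 * (Real.sin ((t + s) / 2) * Real.sin ((t - s) / 2)) := by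
    rw [← neg_sub, Real.cos_sub_cos]; ring
  rw [e1, e2, mul_assoc, abs_mul, abs_mul]
  norm_num
  exact mul_le_mul (key _ (by linarith) (by linarith)) (key _ (by linarith) (by linarith))
    (abs_nonneg _) (Real.sin_nonneg_of_nonneg_of_le_pi (by linarith) (by linarith))

/-- The derivative in `u` is `cos (u x) - u x sin (u x)`, nonnegative because `u x ≤ π/4 ≤ 1` and
sine is at most cosine there. It makes `sin (t y) - sin (s y)` monotone in `y` on `[0,1]`. -/
theorem mul_cos_mul_le_mul_cos_mul {s t x : ℝ} (hs : 0 ≤ s) (hst : s ≤ t) (ht : t ≤ Real.pi / 4)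
    (hx0 : 0 ≤ x) (hx : x ≤ 1) : s * Real.cos (s * x) ≤ t * Real.cos (t * x) := by
  have hpi := Real.pi_pos
  have hd : ∀ u, HasDerivAt (fun u : ℝ => u * Real.cos (u * x))
      (Real.cos (u * x) - u * x * Real.sin (u * x)) u := by
    intro u
    have h1 : HasDerivAt (fun u : ℝ => u * x) x u := by simpa using (hasDerivAt_id u).mul_const x
    have h2 := (hasDerivAt_id u).mul h1.cos
    refine h2.congr_deriv ?_
    simp only [id]; ring
  have hm : MonotoneOn (fun u : ℝ => u * Real.cos (u * x)) (Set.Icc 0 (Real.pi / 4)) := by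
    refine monotoneOn_of_deriv_nonneg (convex_Icc _ _)
      (fun u _ => (hd u).continuousAt.continuousWithinAt)
      (fun u _ => (hd u).differentiableAt.differentiableWithinAt) fun u hu => ?_
    rw [interior_Icc] at hu
    rw [(hd u).deriv]
    have hv0 : 0 ≤ u * x := mul_nonneg hu.1.le hx0
    have hv1 : u * x ≤ Real.pi / 4 := (mul_le_of_le_one_right hu.1.le hx).trans hu.2.le
    have hs0 : 0 ≤ Real.sin (u * x) := Real.sin_nonneg_of_nonneg_of_le_pi hv0 (by linarith)
    have hc : Real.sin (u * x) ≤ Real.cos (u * x) := by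
      rw [← Real.cos_pi_div_two_sub]
      exact Real.cos_le_cos_of_nonneg_of_le_pi hv0 (by linarith) (by linarith)
    have hpi4 := Real.pi_le_four
    have : u * x * Real.sin (u * x) ≤ 1 * Real.sin (u * x) :=
      mul_le_mul_of_nonneg_right (by linarith) hs0
    linarith
  exact hm ⟨hs, hst.trans ht⟩ ⟨hs.trans hst, ht⟩ hst

theorem abs_sin_mul_sub_sin_mul_le {s t x : ℝ} (hs : 0 ≤ s) (hst : s ≤ t) (ht : t ≤ Real.pi / 4)
    (hx : |x| ≤ 1) : |Real.sin (t * x) - Real.sin (s * x)| ≤ Real.sin t - Real.sin s := by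
  have hd : ∀ y, HasDerivAt (fun y : ℝ => Real.sin (t * y) - Real.sin (s * y))
      (t * Real.cos (t * y) - s * Real.cos (s * y)) y := by
    intro y
    have h1 : HasDerivAt (fun y : ℝ => t * y) t y := by simpa using (hasDerivAt_id y).const_mul t
    have h2 : HasDerivAt (fun y : ℝ => s * y) s y := by simpa using (hasDerivAt_id y).const_mul s
    refine (h1.sin.sub h2.sin).congr_deriv ?_
    ring
  have hm : MonotoneOn (fun y : ℝ => Real.sin (t * y) - Real.sin (s * y)) (Set.Icc 0 1) := by
    refine monotoneOn_of_deriv_nonneg (convex_Icc _ _)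
      (fun u _ => (hd u).continuousAt.continuousWithinAt)
      (fun u _ => (hd u).differentiableAt.differentiableWithinAt) fun u hu => ?_
    rw [interior_Icc] at hu
    rw [(hd u).deriv, sub_nonneg]
    exact mul_cos_mul_le_mul_cos_mul hs hst ht hu.1.le hu.2.le
  have key : ∀ y, 0 ≤ y → y ≤ 1 →
      |Real.sin (t * y) - Real.sin (s * y)| ≤ Real.sin t - Real.sin s := by
    intro y hy0 hy1
    have h0 := hm ⟨le_rfl, zero_le_one⟩ ⟨hy0, hy1⟩ hy0
    have h1 := hm ⟨hy0, hy1⟩ ⟨zero_le_one, le_rfl⟩ hy1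
    simp only [mul_zero, Real.sin_zero, sub_zero, mul_one] at h0 h1
    rwa [abs_of_nonneg h0]
  rcases le_total 0 x with h | h
  · exact key x h ((le_abs_self x).trans hx)
  · have := key (-x) (by linarith) ((neg_le_abs x).trans hx)
    rwa [mul_neg, mul_neg, Real.sin_neg, Real.sin_neg, ← neg_sub', abs_neg] at this

/-- Multiplication by a bounded continuous function on `L²`. -/
theorem exists_mulOp {μ : Measure ℝ} {g : ℝ → ℂ} (hg : Continuous g) {C : ℝ} (hC : ∀ x, ‖g x‖ ≤ C) :
    ∃ M : Lp ℂ 2 μ →L[ℂ] Lp ℂ 2 μ, ∀ f, M f =ᵐ[μ] fun x => g x * f x := by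
  have hmem : ∀ f : Lp ℂ 2 μ, MemLp (fun x => g x * f x) 2 μ := fun f =>
    (Lp.memLp f).of_le_mul (hg.aestronglyMeasurable.mul (Lp.aestronglyMeasurable f))
      (ae_of_all _ fun x => by
        rw [norm_mul]
        exact mul_le_mul_of_nonneg_right (hC x) (norm_nonneg _))
  let M₀ : Lp ℂ 2 μ →ₗ[ℂ] Lp ℂ 2 μ :=
    { toFun := fun f => (hmem f).toLp _
      map_add' := fun f f' => by
        apply Lp.ext
        filter_upwards [(hmem (f + f')).coeFn_toLp, (hmem f).coeFn_toLp, (hmem f').coeFn_toLp,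
          Lp.coeFn_add f f', Lp.coeFn_add ((hmem f).toLp _) ((hmem f').toLp _)]
          with x h1 h2 h3 h4 h5
        rw [h1, h5, Pi.add_apply, h2, h3, h4, Pi.add_apply, mul_add]
      map_smul' := fun a f => by
        apply Lp.ext
        filter_upwards [(hmem (a • f)).coeFn_toLp, (hmem f).coeFn_toLp, Lp.coeFn_smul a f,
          Lp.coeFn_smul a ((hmem f).toLp _)] with x h1 h2 h3 h4
        simp only [RingHom.id_apply]
        rw [h1, h4, Pi.smul_apply, h2, h3, Pi.smul_apply, smul_eq_mul, smul_eq_mul]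
        ring }
  refine ⟨M₀.mkContinuous C fun f => Lp.norm_le_mul_norm_of_ae_le_mul ?_,
    fun f => (hmem f).coeFn_toLp⟩
  filter_upwards [(hmem f).coeFn_toLp] with x hx
  change ‖((hmem f).toLp _ : Lp ℂ 2 μ) x‖ ≤ _
  rw [hx, norm_mul]
  exact mul_le_mul_of_nonneg_right (hC x) (norm_nonneg _)

/-- Lebesgue measure on `[0,1]`. -/
local notation "μI" => (volume.restrict (Set.Icc (0 : ℝ) 1) : Measure ℝ)

theorem integral_Icc_eq_intervalIntegral (f : ℝ → ℂ) :
    ∫ x, f x ∂μI = ∫ x in (0 : ℝ)..1, f x := by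
  rw [intervalIntegral.integral_of_le zero_le_one, integral_Icc_eq_integral_Ioc]

/-- The exponentials `e^{2πikt}` with arbitrary phases form a Hilbert basis of `L²[0,1]`. -/
theorem exists_hilbertBasis_exp (θ : ℤ → ℝ)
    (he : ∀ k : ℤ, MemLp (fun t : ℝ => Complex.exp (Complex.I * (θ k + 2 * Real.pi * k * t))) 2 μI) :
    ∃ b : HilbertBasis ℤ ℂ (Lp ℂ 2 μI), ∀ k, b k = (he k).toLp := by
  have horth : Orthonormal ℂ fun k => (he k).toLp := by
    rw [orthonormal_iff_ite]
    intro i j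
    rw [L2.inner_def]
    have h1 : ∫ a, inner ℂ ((he i).toLp _ a) ((he j).toLp _ a) ∂μI =
        ∫ t in (0 : ℝ)..1, Complex.exp (Complex.I * (θ j - θ i)) *
          Complex.exp (2 * Real.pi * Complex.I * (j - i) * t) := by
      rw [← integral_Icc_eq_intervalIntegral]
      refine integral_congr_ae ?_
      filter_upwards [(he i).coeFn_toLp, (he j).coeFn_toLp] with t h1 h2
      rw [h1, h2, RCLike.inner_apply, ← Complex.exp_conj, ← Complex.exp_add, ← Complex.exp_add]
      congr 1
      simp [Complex.conj_ofNat]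
      ring
    rw [h1, intervalIntegral.integral_const_mul]
    split_ifs with hij
    · subst hij; simp
    · have hne : (2 * Real.pi * Complex.I * (j - i) : ℂ) ≠ 0 := by
        have : (j - i : ℂ) ≠ 0 := by
          rw [sub_ne_zero]; exact_mod_cast Ne.symm hij
        simp [this, Real.pi_ne_zero]
      rw [integral_exp_mul_complex hne]
      have : Complex.exp (2 * Real.pi * Complex.I * (j - i) * (1 : ℝ)) = 1 := by
        rw [Complex.exp_eq_one_iff]
        exact ⟨j - i, by push_cast; ring⟩
      rw [this]
      norm_num
  refine ⟨HilbertBasis.mkOfOrthogonalEqBot horth ?_, fun k => by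
    rw [HilbertBasis.coe_mkOfOrthogonalEqBot]⟩
  rw [Submodule.eq_bot_iff]
  intro f hf
  have hf0 : ∀ k, inner ℂ ((he k).toLp) f = 0 := fun k =>
    (Submodule.mem_orthogonal _ _).mp hf _ (Submodule.subset_span ⟨k, rfl⟩)
  have hIoc : (volume.restrict (Set.Ioc (0 : ℝ) 1) : Measure ℝ) = μI :=
    Measure.restrict_congr_set Ioc_ae_eq_Icc
  have hmem : MemLp f 2 (volume.restrict (Set.Ioc (0 : ℝ) 1)) := by
    rw [hIoc]; exact Lp.memLp f
  -- Parseval: once all Fourier coefficients vanish, so does the norm.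
  have hs := hasSum_sq_fourierCoeffOn zero_lt_one hmem
  have hc : ∀ k, fourierCoeffOn (zero_lt_one' ℝ) f k = 0 := by
    intro k
    rw [fourierCoeffOn_eq_integral, ← integral_Icc_eq_intervalIntegral]
    have h1 := hf0 k
    rw [L2.inner_def] at h1
    have h2 : ∫ a, inner ℂ ((he k).toLp _ a) (f a) ∂μI = Complex.exp (-(Complex.I * θ k)) *
        ∫ x, fourier (-k) (x : AddCircle ((1 : ℝ) - 0)) • f x ∂μI := by
      rw [← integral_const_mul]
      refine integral_congr_ae ?_
      filter_upwards [(he k).coeFn_toLp] with t h1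
      rw [h1, RCLike.inner_apply, ← Complex.exp_conj, fourier_coe_apply, smul_eq_mul, ← mul_assoc,
        ← Complex.exp_add, mul_comm]
      congr 2
      simp [Complex.conj_ofNat]
      ring
    rw [h2] at h1
    rw [(mul_eq_zero.mp h1).resolve_left (Complex.exp_ne_zero _), smul_zero]
  simp only [hc, norm_zero, ne_eq, OfNat.ofNat_ne_zero, not_false_eq_true, zero_pow] at hs
  have h0 := hs.unique hasSum_zero
  have h1 : ∫ x, ‖f x‖ ^ 2 ∂μI = 0 := by
    rw [integral_Icc_eq_integral_Ioc, ← intervalIntegral.integral_of_le zero_le_one]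
    simpa using h0
  rw [← inner_self_eq_zero (𝕜 := ℂ), L2.inner_def]
  have h2 : ∫ a, inner ℂ (f a) (f a) ∂μI = ((∫ x, ‖f x‖ ^ 2 ∂μI : ℝ) : ℂ) := by
    rw [← integral_complex_ofReal]
    refine integral_congr_ae (ae_of_all _ fun t => ?_)
    simp [inner_self_eq_norm_sq_to_K]
  rw [h2, h1, Complex.ofReal_zero]

/-- **Kadec's 1/4-theorem.** -/
theorem isRieszBasis_exp_of_abs_sub_le {ω : ℤ → ℝ} {D : ℝ} (hD : D < Real.pi / 4)
    (hω : ∀ k : ℤ, |ω k - k * Real.pi| ≤ D)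
    (hf : ∀ k : ℤ, MemLp (fun t : ℝ => Complex.exp (2 * Complex.I * (ω k : ℂ) * (t : ℂ))) 2 μI) :
    IsRieszBasis fun k => (hf k).toLp := by
  have hpi := Real.pi_pos
  set δ : ℤ → ℝ := fun k => ω k - k * Real.pi with hδ
  have hD0 : 0 ≤ D := (abs_nonneg _).trans (hω 0)
  -- The phase `δ k` in the basis vector centres the perturbation: the remaining factor is `exp (i
  -- δ_k (2t - 1))` with `|2t - 1| ≤ 1`, which doubles the admissible range of `δ`.
  have he : ∀ k : ℤ, MemLp
      (fun t : ℝ => Complex.exp (Complex.I * (δ k + 2 * Real.pi * k * t))) 2 μI := by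
    intro k
    refine MemLp.of_bound (by fun_prop) 1 (ae_of_all _ fun t => ?_)
    have : (Complex.I * (δ k + 2 * Real.pi * k * t) : ℂ) =
      ((δ k + 2 * Real.pi * k * t : ℝ) : ℂ) * Complex.I := by push_cast; ring
    rw [this, Complex.norm_exp_ofReal_mul_I]
  obtain ⟨b, hb⟩ := exists_hilbertBasis_exp δ he
  have hcos : ∀ r : ℝ, ∃ M : Lp ℂ 2 μI →L[ℂ] Lp ℂ 2 μI, ∀ f,
      M f =ᵐ[μI] fun t : ℝ => ((Real.cos (r * (2 * t - 1)) : ℝ) : ℂ) * f t := fun r =>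
    exists_mulOp (g := fun t : ℝ => ((Real.cos (r * (2 * t - 1)) : ℝ) : ℂ)) (by fun_prop)
      (C := 1) fun x => by rw [Complex.norm_real]; exact Real.abs_cos_le_one _
  have hsin : ∀ r : ℝ, ∃ M : Lp ℂ 2 μI →L[ℂ] Lp ℂ 2 μI, ∀ f,
      M f =ᵐ[μI] fun t : ℝ => ((Real.sin (r * (2 * t - 1)) : ℝ) : ℂ) * f t := fun r =>
    exists_mulOp (g := fun t : ℝ => ((Real.sin (r * (2 * t - 1)) : ℝ) : ℂ)) (by fun_prop)
      (C := 1) fun x => by rw [Complex.norm_real]; exact Real.abs_sin_le_one _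
  choose C hC using hcos
  choose S hS using hsin
  have hmem : ∀ᵐ t ∂μI, |2 * t - 1| ≤ 1 := by
    filter_upwards [ae_restrict_mem measurableSet_Icc] with t ht
    rw [abs_le]
    constructor <;> linarith [ht.1, ht.2]
  have hCb : ∀ s t, 0 ≤ s → s ≤ t → t ≤ D → ‖C t - C s‖ ≤ -Real.cos t - -Real.cos s := by
    intro s t hs hst ht
    have hst' : 0 ≤ Real.cos s - Real.cos t :=
      (abs_nonneg _).trans (abs_cos_mul_sub_cos_mul_le hs hst (by linarith) (x := 0) (by simp))
    refine ContinuousLinearMap.opNorm_le_bound _ (by linarith) fun f =>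
      Lp.norm_le_mul_norm_of_ae_le_mul ?_
    filter_upwards [hC t f, hC s f, Lp.coeFn_sub (C t f) (C s f), hmem] with x h1 h2 h3 h4
    rw [sub_apply, h3, Pi.sub_apply, h1, h2, ← sub_mul, norm_mul, ← Complex.ofReal_sub,
      Complex.norm_real]
    refine mul_le_mul_of_nonneg_right ?_ (norm_nonneg _)
    have := abs_cos_mul_sub_cos_mul_le hs hst (by linarith) h4
    rw [Real.norm_eq_abs]
    linarith
  have hSb : ∀ s t, 0 ≤ s → s ≤ t → t ≤ D → ‖S t - S s‖ ≤ Real.sin t - Real.sin s := by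
    intro s t hs hst ht
    have hst' : 0 ≤ Real.sin t - Real.sin s :=
      (abs_nonneg _).trans (abs_sin_mul_sub_sin_mul_le hs hst (by linarith) (x := 0) (by simp))
    refine ContinuousLinearMap.opNorm_le_bound _ hst' fun f =>
      Lp.norm_le_mul_norm_of_ae_le_mul ?_
    filter_upwards [hS t f, hS s f, Lp.coeFn_sub (S t f) (S s f), hmem] with x h1 h2 h3 h4
    rw [sub_apply, h3, Pi.sub_apply, h1, h2, ← sub_mul, norm_mul, ← Complex.ofReal_sub,
      Complex.norm_real]
    exact mul_le_mul_of_nonneg_right (abs_sin_mul_sub_sin_mul_le hs hst (by linarith) h4)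
      (norm_nonneg _)
  -- The operators are indexed by `|δ k|`. Cosine is even, and the sign lost in the sine is moved
  -- into the coefficients, where it has modulus one.
  let sg : ℤ → ℂ := fun k => if 0 ≤ δ k then 1 else -1
  have hsg : ∀ k, ‖sg k‖ = 1 := fun k => by simp only [sg]; split_ifs <;> simp
  have hd : ∀ k, b k - (hf k).toLp =
      -((C |δ k| - C 0) (b k)) - (Complex.I * sg k) • (S |δ k| - S 0) (b k) := by
    intro k
    apply Lp.ext
    filter_upwards [Lp.coeFn_sub (b k) ((hf k).toLp),
      Lp.coeFn_sub (-((C |δ k| - C 0) (b k))) ((Complex.I * sg k) • (S |δ k| - S 0) (b k)),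
      Lp.coeFn_neg ((C |δ k| - C 0) (b k)), Lp.coeFn_sub (C |δ k| (b k)) (C 0 (b k)),
      Lp.coeFn_smul (Complex.I * sg k) ((S |δ k| - S 0) (b k)),
      Lp.coeFn_sub (S |δ k| (b k)) (S 0 (b k)), hC |δ k| (b k), hC 0 (b k), hS |δ k| (b k),
      hS 0 (b k), (hf k).coeFn_toLp, (he k).coeFn_toLp] with t h1 h2 h3 h4 h5 h6 h7 h8 h9 h10 h11 h12
    rw [← hb] at h12
    rw [h1, h2, Pi.sub_apply, Pi.sub_apply, h3, Pi.neg_apply, sub_apply, h4, Pi.sub_apply, h5,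
      Pi.smul_apply, sub_apply, h6, Pi.sub_apply, h7, h8, h9, h10, h11]
    have hexp : Complex.exp (2 * Complex.I * (ω k : ℂ) * (t : ℂ)) =
        Complex.exp (((δ k * (2 * t - 1) : ℝ) : ℂ) * Complex.I) * b k t := by
      rw [h12, ← Complex.exp_add]
      congr 1
      simp only [hδ]
      push_cast
      ring
    rw [hexp, Complex.exp_mul_I, ← Complex.ofReal_cos, ← Complex.ofReal_sin]
    simp only [zero_mul, Real.cos_zero, Real.sin_zero, smul_eq_mul, Complex.ofReal_one,
      Complex.ofReal_zero, sg]
    split_ifs with hk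
    · rw [abs_of_nonneg hk]; ring
    · rw [abs_of_neg (not_le.mp hk), neg_mul, Real.cos_neg, Real.sin_neg, Complex.ofReal_neg]; ring
  -- The cosine and sine parts contribute `1 - cos D` and `sin D`; their sum is below one exactly
  -- when this holds.
  have hsc : Real.sin D < Real.cos D := by
    rw [← Real.cos_pi_div_two_sub]
    exact Real.cos_lt_cos_of_nonneg_of_le_pi hD0 (by linarith) (by linarith)
  have hsD : 0 ≤ Real.sin D := Real.sin_nonneg_of_nonneg_of_le_pi hD0 (by linarith)
  obtain ⟨T, hT⟩ := b.exists_equiv_of_perturbation (fun k => b k - (hf k).toLp)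
    (ρ := (1 - Real.cos D) + Real.sin D) (by linarith [Real.cos_le_one D]) (by linarith)
    (by
      intro s c
      have h1 := b.orthonormal.norm_sum_increment_le hCb (fun k => |δ k|) c s 0 le_rfl hD0
        fun k _ => ⟨abs_nonneg _, hω k⟩
      have h2 := b.orthonormal.norm_sum_increment_le hSb (fun k => |δ k|)
        (fun k => c k * (Complex.I * sg k)) s 0 le_rfl hD0 fun k _ => ⟨abs_nonneg _, hω k⟩
      have h3 : ∑ k ∈ s, c k • (b k - (hf k).toLp) =
          -(∑ k ∈ s, c k • (C |δ k| - C 0) (b k)) -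
            ∑ k ∈ s, (c k * (Complex.I * sg k)) • (S |δ k| - S 0) (b k) := by
        rw [← Finset.sum_neg_distrib, ← Finset.sum_sub_distrib]
        refine Finset.sum_congr rfl fun k _ => ?_
        rw [hd k, smul_sub, smul_neg, smul_smul]
      simp only [norm_mul, hsg, Complex.norm_I, mul_one] at h2
      rw [h3]
      refine (norm_sub_le _ _).trans ?_
      rw [norm_neg]
      simp only [Real.cos_zero, Real.sin_zero] at h1 h2
      calc _ ≤ _ := add_le_add h1 h2
        _ = _ := by ring)
  exact ⟨b, T, fun k => by rw [hT]; abel⟩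

end Kadec

/-! ### Poisson's integral for the Bessel function. -/

section Poisson

theorem sub_sq_pos {u : ℝ} (hu : u ∈ Set.Ioo (0 : ℝ) 1) : 0 < u - u ^ 2 := by
  nlinarith [hu.1, hu.2]

theorem ofReal_weight_eq {a u : ℝ} (hu : u ∈ Set.Ioo (0 : ℝ) 1) :
    (((u - u ^ 2) ^ a : ℝ) : ℂ) =
      (u : ℂ) ^ ((a + 1 : ℂ) - 1) * (1 - (u : ℂ)) ^ ((a + 1 : ℂ) - 1) := by
  have h1 : u - u ^ 2 = u * (1 - u) := by ring
  rw [h1, Real.mul_rpow hu.1.le (by linarith [hu.2]), add_sub_cancel_right, Complex.ofReal_mul,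
    Complex.ofReal_cpow hu.1.le, Complex.ofReal_cpow (by linarith [hu.2])]
  simp

theorem ae_Ioc_mem_Ioo : ∀ᵐ u : ℝ ∂volume.restrict (Set.Ioc (0 : ℝ) 1), u ∈ Set.Ioo (0 : ℝ) 1 := by
  rw [← Measure.restrict_congr_set (Ioo_ae_eq_Ioc (μ := volume) (a := (0 : ℝ)) (b := 1))]
  exact ae_restrict_mem measurableSet_Ioo

theorem intervalIntegrable_weight {a : ℝ} (ha : -1 < a) :
    IntervalIntegrable (fun u : ℝ => (u - u ^ 2) ^ a) volume 0 1 := by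
  have h1 : 0 < ((a : ℂ) + 1).re := by simp; linarith
  have h2 := Complex.betaIntegral_convergent h1 h1
  rw [intervalIntegrable_iff, Set.uIoc_of_le zero_le_one] at h2 ⊢
  refine h2.norm.congr ?_
  filter_upwards [ae_Ioc_mem_Ioo] with u hu
  rw [← ofReal_weight_eq hu, Complex.norm_real, Real.norm_of_nonneg]
  exact Real.rpow_nonneg (sub_sq_pos hu).le _

theorem intervalIntegrable_ofReal_weight {a : ℝ} (ha : -1 < a) :
    IntervalIntegrable (fun u : ℝ => (((u - u ^ 2) ^ a : ℝ) : ℂ)) volume 0 1 := by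
  have h := intervalIntegrable_weight ha
  rw [intervalIntegrable_iff] at h ⊢
  exact h.ofReal

theorem integral_weight {a : ℝ} (ha : -1 < a) :
    ∫ u in (0 : ℝ)..1, (u - u ^ 2) ^ a = Real.Gamma (a + 1) ^ 2 / Real.Gamma (2 * a + 2) := by
  have h1 : 0 < ((a : ℂ) + 1).re := by simp; linarith
  have h2 := Complex.Gamma_mul_Gamma_eq_betaIntegral h1 h1
  have h3 : Complex.betaIntegral (a + 1) (a + 1) =
      ((∫ u in (0 : ℝ)..1, (u - u ^ 2) ^ a : ℝ) : ℂ) := by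
    rw [Complex.betaIntegral, ← intervalIntegral.integral_ofReal]
    rw [intervalIntegral.integral_of_le zero_le_one, intervalIntegral.integral_of_le zero_le_one]
    refine integral_congr_ae ?_
    filter_upwards [ae_Ioc_mem_Ioo] with u hu
    exact (ofReal_weight_eq hu).symm
  rw [h3] at h2
  have h4 : ((a : ℂ) + 1) = ((a + 1 : ℝ) : ℂ) := by push_cast; rfl
  rw [h4, ← Complex.ofReal_add, Complex.Gamma_ofReal, Complex.Gamma_ofReal, ← Complex.ofReal_mul,
    ← Complex.ofReal_mul, Complex.ofReal_inj] at h2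
  have h5 : Real.Gamma (2 * a + 2) ≠ 0 := (Real.Gamma_pos_of_pos (by linarith)).ne'
  rw [eq_div_iff h5, sq, h2]
  ring_nf

theorem intervalIntegrable_mul_weight {a : ℝ} (ha : -1 < a) {p : ℝ → ℝ} (hp : Continuous p) :
    IntervalIntegrable (fun u : ℝ => p u * (u - u ^ 2) ^ a) volume 0 1 :=
  (intervalIntegrable_weight ha).continuousOn_mul hp.continuousOn

/-- Integrate the derivative of `(1 - 2u)^(2m+1) (u - u²)^(a+1)`, which vanishes at both endpoints,
and use `(1 - 2u)² = 1 - 4(u - u²)`. -/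
theorem integral_even_moment_succ {a : ℝ} (ha : -1 < a) (m : ℕ) :
    (m + a + 3 / 2) * ∫ u in (0 : ℝ)..1, (1 - 2 * u) ^ (2 * (m + 1)) * (u - u ^ 2) ^ a =
      (m + 1 / 2) * ∫ u in (0 : ℝ)..1, (1 - 2 * u) ^ (2 * m) * (u - u ^ 2) ^ a := by
  have hi : ∀ n : ℕ, IntervalIntegrable (fun u : ℝ => (1 - 2 * u) ^ n * (u - u ^ 2) ^ a)
      volume 0 1 := fun n => intervalIntegrable_mul_weight ha (by fun_prop)
  have hd : ∀ u ∈ Set.Ioo (0 : ℝ) 1, HasDerivAt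
      (fun u : ℝ => (1 - 2 * u) ^ (2 * m + 1) * (u - u ^ 2) ^ (a + 1))
      ((m + a + 3 / 2) * ((1 - 2 * u) ^ (2 * (m + 1)) * (u - u ^ 2) ^ a) -
        (m + 1 / 2) * ((1 - 2 * u) ^ (2 * m) * (u - u ^ 2) ^ a)) u := by
    intro u hu
    have hpos := sub_sq_pos hu
    have h1 : HasDerivAt (fun u : ℝ => 1 - 2 * u) (-2) u := by
      simpa using ((hasDerivAt_id u).const_mul (2 : ℝ)).const_sub 1
    have h2 : HasDerivAt (fun u : ℝ => u - u ^ 2) (1 - 2 * u) u := by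
      refine ((hasDerivAt_id' u).sub (hasDerivAt_pow 2 u)).congr_deriv ?_
      simp
    refine ((h1.pow (2 * m + 1)).mul (h2.rpow_const (p := a + 1) (Or.inl hpos.ne'))).congr_deriv ?_
    rw [add_sub_cancel_right, Real.rpow_add_one hpos.ne', Nat.add_sub_cancel]
    push_cast
    simp only [Pi.pow_apply]
    ring
  have h0 := intervalIntegral.integral_eq_sub_of_hasDerivAt_of_le zero_le_one
    (f := fun u : ℝ => (1 - 2 * u) ^ (2 * m + 1) * (u - u ^ 2) ^ (a + 1))
    (by
      refine Continuous.continuousOn ?_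
      exact (by fun_prop : Continuous fun u : ℝ => (1 - 2 * u) ^ (2 * m + 1)).mul
        ((by fun_prop : Continuous fun u : ℝ => u - u ^ 2).rpow_const
          fun _ => Or.inr (by linarith))) hd
    (((hi _).const_mul _).sub ((hi _).const_mul _))
  rw [intervalIntegral.integral_sub ((hi _).const_mul _) ((hi _).const_mul _),
    intervalIntegral.integral_const_mul, intervalIntegral.integral_const_mul] at h0
  have ha1 : a + 1 ≠ 0 := by linarith
  norm_num [Real.zero_rpow ha1] at h0
  linarith

/-- The normalising constant in Poisson's integral for the Bessel function of index `a + 1/2`. -/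
noncomputable def poissonConst (a : ℝ) : ℝ :=
  Real.Gamma (a + 1) * 2 ^ (-1 - 2 * a) * √Real.pi

theorem poissonConst_pos {a : ℝ} (ha : -1 < a) : 0 < poissonConst a := by
  have := Real.Gamma_pos_of_pos (show 0 < a + 1 by linarith)
  have := Real.pi_pos
  unfold poissonConst
  positivity

theorem integral_even_moment {a : ℝ} (ha : -1 < a) (m : ℕ) :
    (∫ u in (0 : ℝ)..1, (1 - 2 * u) ^ (2 * m) * (u - u ^ 2) ^ a) / (2 * m).factorial =
      poissonConst a / (4 ^ m * m.factorial * Real.Gamma (m + a + 3 / 2)) := by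
  induction m with
  | zero =>
    -- Legendre's duplication formula turns the Beta value of the zeroth moment into the required
    -- quotient.
    have h := Real.Gamma_mul_Gamma_add_half (a + 1)
    have e1 : a + 1 + 1 / 2 = a + 3 / 2 := by ring
    have e2 : 2 * (a + 1) = 2 * a + 2 := by ring
    have e3 : 1 - (2 * a + 2) = -1 - 2 * a := by ring
    rw [e1, e2, e3] at h
    have h1 := (Real.Gamma_pos_of_pos (show 0 < a + 3 / 2 by linarith)).ne'
    have h2 := (Real.Gamma_pos_of_pos (show 0 < 2 * a + 2 by linarith)).ne'
    simp only [mul_zero, pow_zero, one_mul, Nat.factorial_zero, Nat.cast_one, div_one,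
      CharP.cast_eq_zero, zero_add]
    rw [integral_weight ha, div_eq_div_iff h2 h1, poissonConst]
    linear_combination Real.Gamma (a + 1) * h
  | succ m ih =>
    have h := integral_even_moment_succ ha m
    have hp : (0 : ℝ) < m + a + 3 / 2 := by
      have : (0 : ℝ) ≤ m := Nat.cast_nonneg m
      linarith
    have hG := (Real.Gamma_pos_of_pos hp).ne'
    have hG1 : Real.Gamma ((m + 1 : ℕ) + a + 3 / 2) =
        (m + a + 3 / 2) * Real.Gamma (m + a + 3 / 2) := by
      rw [← Real.Gamma_add_one hp.ne']
      congr 1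
      push_cast; ring
    have hf : ((2 * (m + 1)).factorial : ℝ) = (2 * m + 2) * (2 * m + 1) * (2 * m).factorial := by
      rw [show 2 * (m + 1) = 2 * m + 1 + 1 by ring, Nat.factorial_succ, Nat.factorial_succ]
      push_cast; ring
    have hf0 : ((2 * m).factorial : ℝ) ≠ 0 := by positivity
    have hm0 : (m.factorial : ℝ) ≠ 0 := by positivity
    rw [hG1, hf, Nat.factorial_succ, pow_succ]
    rw [div_eq_div_iff hf0 (by positivity)] at ih
    rw [div_eq_div_iff (by positivity) (by push_cast; positivity)]
    push_cast
    linear_combination (4 * 4 ^ m * (m + 1) * m.factorial * Real.Gamma (m + a + 3 / 2)) * h +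
      (4 * (m + 1) * (m + 1 / 2)) * ih

/-- The cosine transform of the weight `(u - u²)^a`, centred at `u = 1/2`. -/
noncomputable def cosTransform (a x : ℝ) : ℝ :=
  ∫ u in (0 : ℝ)..1, Real.cos (x * (1 - 2 * u)) * (u - u ^ 2) ^ a

theorem abs_one_sub_two_mul_le {u : ℝ} (hu : u ∈ Set.Ioc (0 : ℝ) 1) : |1 - 2 * u| ≤ 1 := by
  rw [abs_le]
  constructor <;> linarith [hu.1, hu.2]

/-- Term-by-term integration of the cosine series, dominated by `cosh |x|` times the weight. With `a
= ν - 1/2`, the moments produce the coefficients of the Bessel series of index `ν`. -/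
theorem hasSum_cosTransform {a : ℝ} (ha : -1 < a) (x : ℝ) :
    HasSum (fun m : ℕ => (-1) ^ m / (m.factorial * Real.Gamma (m + a + 3 / 2)) * (x / 2) ^ (2 * m))
      (cosTransform a x / poissonConst a) := by
  have h1 : HasSum (fun m : ℕ => ∫ u in (0 : ℝ)..1,
      ((-1) ^ m * (x * (1 - 2 * u)) ^ (2 * m) / (2 * m).factorial) * (u - u ^ 2) ^ a)
      (cosTransform a x) := by
    refine intervalIntegral.hasSum_integral_of_dominated_convergence
      (fun m u => (|x| ^ (2 * m) / (2 * m).factorial) * (u - u ^ 2) ^ a) ?_ ?_ ?_ ?_ ?_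
    · intro m
      have := (intervalIntegrable_iff.mp (intervalIntegrable_mul_weight ha (p := fun u : ℝ =>
        ((-1) ^ m * (x * (1 - 2 * u)) ^ (2 * m) / (2 * m).factorial)) (by fun_prop)))
      exact this.aestronglyMeasurable
    · refine fun m => ae_of_all _ fun u hu => ?_
      rw [Set.uIoc_of_le zero_le_one] at hu
      have hw : 0 ≤ (u - u ^ 2) ^ a := Real.rpow_nonneg (by nlinarith [hu.1, hu.2]) _
      rw [Real.norm_eq_abs, abs_mul, abs_of_nonneg hw]
      refine mul_le_mul_of_nonneg_right ?_ hw
      rw [abs_div, abs_mul, abs_pow, abs_neg, abs_one, one_pow, one_mul, abs_pow, Nat.abs_cast,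
        abs_mul]
      gcongr
      exact mul_le_of_le_one_right (abs_nonneg _) (abs_one_sub_two_mul_le hu)
    · exact ae_of_all _ fun u _ => ((Real.hasSum_cosh |x|).summable).mul_right _
    · simp_rw [tsum_mul_right]
      exact (intervalIntegrable_weight ha).const_mul _
    · exact ae_of_all _ fun u _ => (Real.hasSum_cos _).mul_right _
  have h2 := h1.div_const (poissonConst a)
  have hk := (poissonConst_pos ha).ne'
  refine h2.congr_fun fun m => ?_
  have e : ∀ u : ℝ, ((-1) ^ m * (x * (1 - 2 * u)) ^ (2 * m) / (2 * m).factorial) * (u - u ^ 2) ^ a =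
      ((-1) ^ m * x ^ (2 * m) / (2 * m).factorial) * ((1 - 2 * u) ^ (2 * m) * (u - u ^ 2) ^ a) :=
    fun u => by rw [mul_pow]; ring
  simp_rw [e]
  rw [intervalIntegral.integral_const_mul]
  have h3 := integral_even_moment ha m
  have hf0 : ((2 * m).factorial : ℝ) ≠ 0 := by positivity
  have hG : 0 < Real.Gamma (m + a + 3 / 2) := Real.Gamma_pos_of_pos (by
    have : (0 : ℝ) ≤ m := Nat.cast_nonneg m
    linarith)
  rw [div_pow, pow_mul (2 : ℝ), show (2 : ℝ) ^ 2 = 4 by norm_num]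
  rw [div_mul_eq_mul_div _ _ (∫ u in (0 : ℝ)..1, _), mul_div_assoc ((-1) ^ m * x ^ (2 * m)), h3]
  field_simp

theorem besselJ_ofReal_eq {ν : ℝ} (hν : -(1 / 2) < ν) (x : ℝ) :
    besselJ ν x = ((x : ℂ) / 2) ^ (ν : ℂ) *
      ((cosTransform (ν - 1 / 2) x / poissonConst (ν - 1 / 2) : ℝ) : ℂ) := by
  rw [besselJ]
  congr 1
  rw [← (Complex.hasSum_ofReal.mpr (hasSum_cosTransform (a := ν - 1 / 2) (by linarith) x)).tsum_eq]
  refine tsum_congr fun m => ?_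
  have : (m : ℂ) + ν + 1 = ((m + (ν - 1 / 2) + 3 / 2 : ℝ) : ℂ) := by push_cast; ring
  rw [this, Complex.Gamma_ofReal]
  push_cast
  rfl

theorem besselJ_ofReal_eq_zero_iff {ν : ℝ} (hν : 0 < ν) (x : ℝ) :
    besselJ ν x = 0 ↔ x = 0 ∨ cosTransform (ν - 1 / 2) x = 0 := by
  rw [besselJ_ofReal_eq (by linarith), mul_eq_zero, Complex.cpow_eq_zero_iff, Complex.ofReal_eq_zero,
    div_eq_zero_iff, div_eq_zero_iff,
    or_iff_left (poissonConst_pos (a := ν - 1 / 2) (by linarith)).ne']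
  simp [hν.ne']

/-- Both principal powers use the same logarithm of `x`, so `x^H (x/2)^(1-H) = 2^(H-1) x` for
negative `x` too. The right side is the odd entire function meant in the definition of `φ_k`. -/
theorem cpow_mul_besselJ {H : ℝ} (hH : H ∈ Set.Ioo (0 : ℝ) 1) (x : ℝ) :
    (x : ℂ) ^ (H : ℂ) * besselJ (1 - H) x =
      ((2 ^ (H - 1) * x * (cosTransform (1 / 2 - H) x / poissonConst (1 / 2 - H)) : ℝ) : ℂ) := by
  have h1 : (1 - H : ℂ) = ((1 - H : ℝ) : ℂ) := by push_cast; rfl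
  rw [h1, besselJ_ofReal_eq (by linarith [hH.2]), show 1 - H - 1 / 2 = 1 / 2 - H by ring]
  rcases eq_or_ne x 0 with rfl | hx
  · simp [hH.1.ne']
  have hx' : (x : ℂ) ≠ 0 := by exact_mod_cast hx
  have h2 : ((x : ℂ) / 2) ^ ((1 - H : ℝ) : ℂ) = ((2 ^ (H - 1) : ℝ) : ℂ) * (x : ℂ) ^ (1 - H : ℂ) := by
    have h3 : (x : ℂ) / 2 = x * ((2⁻¹ : ℝ) : ℂ) := by push_cast; ring
    rw [h3, Complex.cpow_def_of_ne_zero (by simp [hx]), Complex.log_mul_ofReal _ (by norm_num) _ hx',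
      Complex.cpow_def_of_ne_zero hx', Real.log_inv, Real.rpow_def_of_pos two_pos,
      Complex.ofReal_exp, ← Complex.exp_add]
    congr 1
    push_cast
    ring
  rw [h2]
  have h4 : (x : ℂ) ^ (H : ℂ) * (x : ℂ) ^ (1 - H : ℂ) = x := by
    rw [← Complex.cpow_add _ _ hx']; simp
  push_cast
  linear_combination (((2 : ℝ) ^ (H - 1) : ℝ) : ℂ) * (cosTransform (1 / 2 - H) x /
    poissonConst (1 / 2 - H)) * h4

end Poisson

/-! ### Location of the zeros by contour rotation. -/

section Zeros

open Complex in
/-- The integrand of Poisson's integral, continued to the strip `0 ≤ re z ≤ 1`. -/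
noncomputable def poissonIntegrand (a l : ℝ) (z : ℂ) : ℂ :=
  exp (-I * l * (1 - 2 * z)) * (z - z ^ 2) ^ (a : ℂ)

theorem sub_sq_re (x y : ℝ) : ((x + y * Complex.I : ℂ) - (x + y * Complex.I) ^ 2).re =
    x - x ^ 2 + y ^ 2 := by
  simp [sq]; ring

theorem sub_sq_mem_slitPlane {z : ℂ} (h0 : 0 ≤ z.re) (h1 : z.re ≤ 1) (hi : 0 < z.im) :
    z - z ^ 2 ∈ Complex.slitPlane := by
  left
  rw [← Complex.re_add_im z, sub_sq_re]
  nlinarith [pow_pos hi 2]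

theorem norm_poissonIntegrand (a l x y : ℝ) :
    ‖poissonIntegrand a l (x + y * Complex.I)‖ = Real.exp (-(2 * l * y)) *
      ‖(x + y * Complex.I : ℂ) - (x + y * Complex.I) ^ 2‖ ^ a := by
  rw [poissonIntegrand, norm_mul, Complex.norm_cpow_real, Complex.norm_exp]
  congr 2
  simp
  ring

theorem norm_sub_sq_le {x y : ℝ} (hx0 : 0 ≤ x) (hx1 : x ≤ 1) (hy : 0 ≤ y) :
    ‖(x + y * Complex.I : ℂ) - (x + y * Complex.I) ^ 2‖ ≤ (1 + y) ^ 2 := by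
  have h1 : (x + y * Complex.I : ℂ) - (x + y * Complex.I) ^ 2 =
      (x + y * Complex.I) * (((1 - x : ℝ) : ℂ) + ((-y : ℝ) : ℂ) * Complex.I) := by
    push_cast; ring
  rw [h1, norm_mul, sq]
  have hn : ∀ p q : ℝ, ‖(p : ℂ) + q * Complex.I‖ ≤ |p| + |q| := by
    intro p q
    refine (norm_add_le _ _).trans ?_
    simp
  refine mul_le_mul ((hn _ _).trans ?_) ((hn _ _).trans ?_) (norm_nonneg _) (by linarith)
  · rw [abs_of_nonneg hx0, abs_of_nonneg hy]; linarith
  · rw [abs_of_nonneg (by linarith), abs_neg, abs_of_nonneg hy]; linarith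

theorem le_norm_sub_sq (x y : ℝ) :
    x - x ^ 2 + y ^ 2 ≤ ‖(x + y * Complex.I : ℂ) - (x + y * Complex.I) ^ 2‖ := by
  rw [← sub_sq_re]
  exact Complex.re_le_norm _

/-- The lower side is kept off the branch points `0` and `1`. For `a ≥ 0` the weight is bounded by
`4^a` up to height one; for `a ≤ 0` it is at most its value on the real axis, because `|z - z²| ≥ x
- x²`. -/
theorem tendsto_integral_bottom {a l : ℝ} (ha : -1 < a) (hl : 0 < l) :
    Tendsto (fun n : ℕ => ∫ x in (0 : ℝ)..1,
        poissonIntegrand a l (x + ((1 / (n + 1) : ℝ) : ℂ) * Complex.I)) atTop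
      (𝓝 (∫ x in (0 : ℝ)..1, Complex.exp (-Complex.I * l * (1 - 2 * x)) *
        (((x - x ^ 2) ^ a : ℝ) : ℂ))) := by
  rw [intervalIntegral.integral_of_le zero_le_one]
  simp_rw [intervalIntegral.integral_of_le zero_le_one]
  refine tendsto_integral_of_dominated_convergence (fun x => (x - x ^ 2) ^ a + 4 ^ |a|) ?_ ?_ ?_ ?_
  · intro n
    refine ContinuousOn.aestronglyMeasurable ?_ measurableSet_Ioc
    intro x hx
    refine ContinuousAt.continuousWithinAt ?_
    have hn : (0 : ℝ) < 1 / (n + 1) := by positivity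
    generalize (1 / (n + 1) : ℝ) = y at hn ⊢
    have hs : (x + (y : ℂ) * Complex.I : ℂ) - (x + y * Complex.I) ^ 2 ∈ Complex.slitPlane :=
      sub_sq_mem_slitPlane (by simpa using hx.1.le) (by simpa using hx.2) (by simpa using hn)
    unfold poissonIntegrand
    refine ContinuousAt.mul (by fun_prop) ?_
    exact ContinuousAt.cpow (by fun_prop) continuousAt_const hs
  · have h1 := intervalIntegrable_weight ha
    rw [intervalIntegrable_iff, Set.uIoc_of_le zero_le_one] at h1
    exact h1.add (integrable_const _)
  · intro n
    filter_upwards [ae_Ioc_mem_Ioo] with x hx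
    have hn : (0 : ℝ) < 1 / (n + 1) := by positivity
    have hn1 : (1 : ℝ) / (n + 1) ≤ 1 := by
      rw [div_le_one (by positivity)]
      linarith [(Nat.cast_nonneg n : (0 : ℝ) ≤ n)]
    set y : ℝ := 1 / (n + 1)
    have hpos := sub_sq_pos hx
    rw [norm_poissonIntegrand]
    have he : Real.exp (-(2 * l * y)) ≤ 1 := Real.exp_le_one_iff.mpr (by
      have := mul_pos hl hn
      linarith)
    have hw : 0 ≤ (x - x ^ 2) ^ a := Real.rpow_nonneg hpos.le _
    refine (mul_le_of_le_one_left (Real.rpow_nonneg (norm_nonneg _) _) he).trans ?_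
    rcases le_total 0 a with h | h
    · rw [abs_of_nonneg h]
      have h1 : ‖(x + y * Complex.I : ℂ) - (x + y * Complex.I) ^ 2‖ ≤ 4 :=
        (norm_sub_sq_le hx.1.le hx.2.le hn.le).trans (by nlinarith)
      have := Real.rpow_le_rpow (norm_nonneg _) h1 h
      linarith
    · have h1 := le_norm_sub_sq x y
      have h2 := Real.rpow_le_rpow_of_nonpos hpos
        (show x - x ^ 2 ≤ ‖(x + y * Complex.I : ℂ) - (x + y * Complex.I) ^ 2‖ by
          nlinarith [sq_nonneg y]) h
      have : (0 : ℝ) ≤ 4 ^ |a| := by positivity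
      linarith
  · filter_upwards [ae_Ioc_mem_Ioo] with x hx
    have hpos := sub_sq_pos hx
    have hs : (x : ℂ) - (x : ℂ) ^ 2 ∈ Complex.slitPlane := by
      left
      rw [← Complex.ofReal_pow, ← Complex.ofReal_sub, Complex.ofReal_re]
      exact hpos
    have hc : ContinuousAt (poissonIntegrand a l) x := by
      unfold poissonIntegrand
      exact ContinuousAt.mul (by fun_prop) (ContinuousAt.cpow (by fun_prop) continuousAt_const hs)
    have hlim : Tendsto (fun n : ℕ => (x : ℂ) + ((1 / (n + 1) : ℝ) : ℂ) * Complex.I) atTop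
        (𝓝 x) := by
      have h1 := (tendsto_one_div_add_atTop_nhds_zero_nat (𝕜 := ℝ))
      have h2 := (Complex.continuous_ofReal.tendsto 0).comp h1
      simpa using (h2.mul_const Complex.I).const_add (x : ℂ)
    have h3 := hc.tendsto.comp hlim
    have h4 : poissonIntegrand a l x =
        Complex.exp (-Complex.I * l * (1 - 2 * x)) * (((x - x ^ 2) ^ a : ℝ) : ℂ) := by
      rw [poissonIntegrand, Complex.ofReal_cpow hpos.le]
      push_cast
      rfl
    rw [h4] at h3
    exact h3

theorem tendsto_integral_top {a l : ℝ} (ha : a ≤ 1) (hl : 0 < l) :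
    Tendsto (fun n : ℕ => ∫ x in (0 : ℝ)..1,
        poissonIntegrand a l (x + ((n + 2 : ℝ) : ℂ) * Complex.I)) atTop (𝓝 0) := by
  have h1 : Tendsto (fun n : ℕ => Real.exp (-(2 * l * (n + 2))) * (2 * (n + 2 : ℝ)) ^ 2) atTop
      (𝓝 0) := by
    have h2 : Tendsto (fun n : ℕ => 2 * l * (n + 2 : ℝ)) atTop atTop :=
      (tendsto_atTop_add_const_right _ _ tendsto_natCast_atTop_atTop).const_mul_atTop
        (by positivity)
    have h3 := ((Real.tendsto_pow_mul_exp_neg_atTop_nhds_zero 2).comp h2).const_mul (1 / l ^ 2)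
    rw [mul_zero] at h3
    refine h3.congr fun n => ?_
    simp only [Function.comp_apply]
    field_simp
  refine squeeze_zero_norm (fun n => ?_) h1
  have h3 : ∀ x ∈ Set.uIoc (0 : ℝ) 1, ‖poissonIntegrand a l (x + ((n + 2 : ℝ) : ℂ) * Complex.I)‖ ≤
      Real.exp (-(2 * l * (n + 2))) * (2 * (n + 2 : ℝ)) ^ 2 := by
    intro x hx
    rw [Set.uIoc_of_le zero_le_one] at hx
    rw [norm_poissonIntegrand]
    refine mul_le_mul_of_nonneg_left ?_ (Real.exp_pos _).le
    have hn : (0 : ℝ) ≤ n := Nat.cast_nonneg n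
    have h4 : 1 ≤ ‖(x + ((n + 2 : ℝ) : ℂ) * Complex.I : ℂ) -
        (x + ((n + 2 : ℝ) : ℂ) * Complex.I) ^ 2‖ :=
      le_trans (by nlinarith [hx.1, hx.2]) (le_norm_sub_sq x (n + 2))
    calc _ ≤ _ := Real.rpow_le_rpow_of_exponent_le h4 ha
      _ ≤ _ := by
        rw [Real.rpow_one]
        refine (norm_sub_sq_le hx.1.le hx.2 (by positivity)).trans ?_
        gcongr
        linarith
  simpa using intervalIntegral.norm_integral_le_of_norm_le_const h3

/-- Cauchy's theorem on `[0,1] × [r,R]`. -/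
theorem integral_bottom_sub_top (a l : ℝ) {r R : ℝ} (hr : 0 < r) (hR : r ≤ R) :
    ((∫ x in (0 : ℝ)..1, poissonIntegrand a l (x + r * Complex.I)) -
      ∫ x in (0 : ℝ)..1, poissonIntegrand a l (x + R * Complex.I)).re =
      2 * ∫ y in r..R, (poissonIntegrand a l (1 + y * Complex.I)).im := by
  have hs : ∀ z : ℂ, z ∈ (Set.uIcc (0 : ℝ) 1) ×ℂ (Set.uIcc r R) →
      z - z ^ 2 ∈ Complex.slitPlane := by
    intro z hz
    rw [Complex.mem_reProdIm, Set.uIcc_of_le zero_le_one, Set.uIcc_of_le hR] at hz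
    exact sub_sq_mem_slitPlane hz.1.1 hz.1.2 (hr.trans_le hz.2.1)
  have hdiff : DifferentiableOn ℂ (poissonIntegrand a l) (Set.uIcc (0 : ℝ) 1 ×ℂ Set.uIcc r R) := by
    intro z hz
    refine DifferentiableAt.differentiableWithinAt ?_
    unfold poissonIntegrand
    exact DifferentiableAt.mul (by fun_prop)
      (DifferentiableAt.cpow_const (by fun_prop) (hs z hz))
  have hcauchy := Complex.integral_boundary_rect_eq_zero_of_differentiableOn
    (poissonIntegrand a l) (r * Complex.I) (1 + R * Complex.I) (by simpa using hdiff)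
  simp only [Complex.mul_re, Complex.ofReal_re, Complex.I_re, mul_zero, Complex.ofReal_im,
    Complex.I_im, mul_one, sub_self, Complex.add_re, Complex.one_re, add_zero, Complex.mul_im,
    zero_add, Complex.add_im, Complex.one_im, Complex.ofReal_one, Complex.ofReal_zero,
    smul_eq_mul] at hcauchy
  -- The reflection `z ↦ 1 - conj z` swaps the vertical sides and conjugates the integrand, so
  -- together they contribute only an imaginary part of one side.
  have hconj : ∀ y ∈ Set.uIcc r R, poissonIntegrand a l (y * Complex.I) =
      (starRingEnd ℂ) (poissonIntegrand a l (1 + y * Complex.I)) := by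
    intro y hy
    rw [Set.uIcc_of_le hR] at hy
    have hsl : (1 + y * Complex.I : ℂ) - (1 + y * Complex.I) ^ 2 ∈ Complex.slitPlane :=
      sub_sq_mem_slitPlane (by simp) (by simp) (by simpa using hr.trans_le hy.1)
    have harg : ((1 + y * Complex.I : ℂ) - (1 + y * Complex.I) ^ 2).arg ≠ Real.pi :=
      Complex.slitPlane_arg_ne_pi hsl
    have hcp := Complex.conj_cpow _ (a : ℂ) harg
    rw [poissonIntegrand, poissonIntegrand, map_mul, ← Complex.exp_conj]
    rw [Complex.conj_ofReal] at hcp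
    rw [← hcp]
    congr 2
    · simp [Complex.conj_ofNat]
      ring
    · simp
      ring
  have hint : ∀ c : ℝ, c ∈ Set.Icc (0 : ℝ) 1 → IntervalIntegrable
      (fun y : ℝ => poissonIntegrand a l (c + y * Complex.I)) volume r R := by
    intro c hc
    refine ContinuousOn.intervalIntegrable ?_
    refine hdiff.continuousOn.comp (by fun_prop) fun y hy => ?_
    rw [Complex.mem_reProdIm, Set.uIcc_of_le zero_le_one]
    simpa using ⟨hc, hy⟩
  have h1 := hint 1 (by simp)
  simp only [Complex.ofReal_one] at h1
  rw [intervalIntegral.integral_congr hconj] at hcauchy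
  have h2 : ∫ y in r..R, (starRingEnd ℂ) (poissonIntegrand a l (1 + y * Complex.I)) =
      (starRingEnd ℂ) (∫ y in r..R, poissonIntegrand a l (1 + y * Complex.I)) := by
    rw [intervalIntegral.integral_of_le hR, intervalIntegral.integral_of_le hR, integral_conj]
  have h3 : (∫ y in r..R, (poissonIntegrand a l (1 + y * Complex.I)).im) =
      (∫ y in r..R, poissonIntegrand a l (1 + y * Complex.I)).im := by
    have := Complex.imCLM.intervalIntegral_comp_comm h1
    simpa using this
  rw [h2] at hcauchy
  have h4 := congrArg Complex.re hcauchy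
  rw [h3]
  simp at h4 ⊢
  linarith

/-- On the side `re z = 1` one has `z - z² = y² - iy`, in the open fourth quadrant. With `-β` its
argument, the power contributes the phase `-aβ` and the exponential the phase `l`. -/
theorem im_poissonIntegrand {a l y : ℝ} (hy : 0 < y) :
    ∃ p > 0, ∃ β ∈ Set.Ioo 0 (Real.pi / 2),
      (poissonIntegrand a l (1 + y * Complex.I)).im = p * Real.sin (l - a * β) := by
  set w : ℂ := (1 + y * Complex.I : ℂ) - (1 + y * Complex.I) ^ 2 with hw
  have hre : w.re = y ^ 2 := by simp [hw, sq]
  have him : w.im = -y := by simp [hw, sq]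
  have hw0 : w ≠ 0 := by
    intro h
    rw [h] at him
    simp at him
    linarith
  refine ⟨Real.exp (-(2 * l * y)) * ‖w‖ ^ a, by positivity, -w.arg, ⟨?_, ?_⟩, ?_⟩
  · have : w.arg < 0 := Complex.arg_neg_iff.mpr (by rw [him]; linarith)
    linarith
  · have := (Complex.abs_arg_lt_pi_div_two_iff (z := w)).mpr (Or.inl (by rw [hre]; positivity))
    rw [abs_lt] at this
    linarith [this.1]
  · rw [poissonIntegrand, ← hw, Complex.cpow_def_of_ne_zero hw0, ← Complex.exp_add,
      Complex.exp_im, Complex.add_re, Complex.add_im, Complex.re_mul_ofReal, Complex.im_mul_ofReal,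
      Complex.log_re, Complex.log_im, Real.exp_add, Real.rpow_def_of_pos (norm_pos_iff.mpr hw0)]
    congr 3
    · simp; ring
    · simp; ring
    · ring

theorem integral_exp_mul_weight_re {a : ℝ} (ha : -1 < a) (l : ℝ) :
    (∫ x in (0 : ℝ)..1, Complex.exp (-Complex.I * l * (1 - 2 * x)) *
        (((x - x ^ 2) ^ a : ℝ) : ℂ)).re = cosTransform a l := by
  have hint : IntervalIntegrable (fun x : ℝ => Complex.exp (-Complex.I * l * (1 - 2 * x)) *
        (((x - x ^ 2) ^ a : ℝ) : ℂ)) volume 0 1 := by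
    have h := intervalIntegrable_ofReal_weight ha
    exact h.continuousOn_mul (by fun_prop)
  have h1 := Complex.reCLM.intervalIntegral_comp_comm hint
  simp only [Complex.reCLM_apply] at h1
  rw [← h1, cosTransform]
  refine intervalIntegral.integral_congr fun x _ => ?_
  have h2 : -Complex.I * l * (1 - 2 * x) = ((-(l * (1 - 2 * x)) : ℝ) : ℂ) * Complex.I := by
    push_cast; ring
  simp only [h2]
  rw [Complex.re_mul_ofReal, Complex.exp_ofReal_mul_I_re, Real.cos_neg]

/-- The sign of the cosine transform, read off after rotating the path of integration. -/
theorem mul_cosTransform_pos {a l σ : ℝ} (ha : -1 < a) (ha1 : a ≤ 1) (hl : 0 < l)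
    (h : ∀ β ∈ Set.Ioo 0 (Real.pi / 2), 0 < σ * Real.sin (l - a * β)) :
    0 < σ * cosTransform a l := by
  have hpos : ∀ y : ℝ, 0 < y → 0 < σ * (poissonIntegrand a l (1 + y * Complex.I)).im := by
    intro y hy
    obtain ⟨p, hp, β, hβ, hE⟩ := im_poissonIntegrand (a := a) (l := l) hy
    rw [hE, mul_left_comm]
    exact mul_pos hp (h β hβ)
  have hcont : ∀ r R : ℝ, 0 < r → r ≤ R →
      ContinuousOn (fun y : ℝ => σ * (poissonIntegrand a l (1 + y * Complex.I)).im)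
        (Set.uIcc r R) := by
    intro r R hr hR y hy
    rw [Set.uIcc_of_le hR] at hy
    have hs : (1 + y * Complex.I : ℂ) - (1 + y * Complex.I) ^ 2 ∈ Complex.slitPlane :=
      sub_sq_mem_slitPlane (by simp) (by simp) (by simpa using hr.trans_le hy.1)
    refine ContinuousAt.continuousWithinAt (continuousAt_const.mul
      (Complex.continuous_im.continuousAt.comp ?_))
    unfold poissonIntegrand
    exact ContinuousAt.mul (by fun_prop) (ContinuousAt.cpow (by fun_prop) continuousAt_const hs)
  -- The part of the side integral over `[1,2]`, contained in every `[1/(n+1), n+2]`: a lower bound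
  -- independent of `n`, so positivity stays strict in the limit.
  set c : ℝ := ∫ y in (1 : ℝ)..2, σ * (poissonIntegrand a l (1 + y * Complex.I)).im
  have hc : 0 < c := intervalIntegral.intervalIntegral_pos_of_pos_on
    (hcont 1 2 one_pos one_le_two).intervalIntegrable
    (fun y hy => hpos y (one_pos.trans hy.1)) one_lt_two
  have hlim := ((tendsto_integral_bottom ha hl).sub (tendsto_integral_top ha1 hl))
  have hlim2 := ((Complex.continuous_re.tendsto _).comp hlim).const_mul σ
  rw [sub_zero, integral_exp_mul_weight_re ha] at hlim2
  refine (mul_pos two_pos hc).trans_le (ge_of_tendsto' hlim2 fun n => ?_)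
  have hn : (0 : ℝ) ≤ n := Nat.cast_nonneg n
  have hn1 : (1 : ℝ) / (n + 1) ≤ 1 := by
    rw [div_le_one (by positivity)]
    linarith
  have hn0 : (0 : ℝ) < 1 / (n + 1) := by positivity
  have := integral_bottom_sub_top a l (r := 1 / (n + 1)) (R := n + 2) hn0 (by linarith)
  rw [Function.comp_apply, this]
  have hle : c ≤ ∫ y in (1 / (n + 1) : ℝ)..(n + 2 : ℝ),
      σ * (poissonIntegrand a l (1 + y * Complex.I)).im := by
    refine intervalIntegral.integral_mono_interval hn1 one_le_two (by linarith) ?_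
      (hcont _ _ hn0 (by linarith)).intervalIntegrable
    refine (ae_restrict_iff' measurableSet_Ioc).mpr (ae_of_all _ fun y hy => ?_)
    exact (hpos y (hn0.trans hy.1)).le
  rw [intervalIntegral.integral_const_mul] at hle
  linarith

theorem cosTransform_neg (a x : ℝ) : cosTransform a (-x) = cosTransform a x := by
  simp [cosTransform]

theorem continuous_cosTransform {a : ℝ} (ha : -1 < a) : Continuous (cosTransform a) := by
  refine intervalIntegral.continuous_of_dominated_interval
    (bound := fun u => ‖(u - u ^ 2) ^ a‖) ?_ ?_ ?_ ?_
  · intro x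
    exact (intervalIntegrable_iff.mp (intervalIntegrable_mul_weight ha
      (p := fun u => Real.cos (x * (1 - 2 * u))) (by fun_prop))).aestronglyMeasurable
  · refine fun x => ae_of_all _ fun u _ => ?_
    rw [norm_mul]
    exact mul_le_of_le_one_left (norm_nonneg _) (Real.abs_cos_le_one _)
  · exact (intervalIntegrable_weight ha).norm
  · exact ae_of_all _ fun u _ => by fun_prop

theorem neg_one_pow_mul_sin_pos {t : ℝ} (m : ℕ) (h0 : m * Real.pi < t) (h1 : t < (m + 1) * Real.pi) :
    0 < (-1) ^ m * Real.sin t := by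
  have h2 : 0 < Real.sin (t - m * Real.pi) :=
    Real.sin_pos_of_pos_of_lt_pi (by linarith) (by linarith)
  rwa [Real.sin_sub_nat_mul_pi] at h2

theorem neg_one_pow_mul_cosTransform_pos {a D l : ℝ} (ha : |a| < 1 / 2)
    (hD : |a| * (Real.pi / 2) < D) (m : ℕ) (h0 : m * Real.pi + D ≤ l)
    (h1 : l ≤ (m + 1) * Real.pi - D) : 0 < (-1) ^ m * cosTransform a l := by
  have hpi := Real.pi_pos
  have hm : (0 : ℝ) ≤ m * Real.pi := by positivity
  have hD0 : 0 < D := lt_of_le_of_lt (by positivity) hD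
  rw [abs_lt] at ha
  refine mul_cosTransform_pos (by linarith) (by linarith) (by linarith) fun β hβ => ?_
  have h2 : |a * β| < D := by
    rw [abs_mul, abs_of_pos hβ.1]
    exact lt_of_le_of_lt (mul_le_mul_of_nonneg_left hβ.2.le (abs_nonneg _)) hD
  rw [abs_lt] at h2
  exact neg_one_pow_mul_sin_pos m (by linarith) (by linarith)

theorem exists_int_near_of_cosTransform_eq_zero {a D x : ℝ} (ha : |a| < 1 / 2)
    (hD : |a| * (Real.pi / 2) < D) (hx : cosTransform a x = 0) :
    ∃ k : ℤ, |x - k * Real.pi| ≤ D := by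
  have hpi := Real.pi_pos
  have key : ∀ y : ℝ, 0 ≤ y → cosTransform a y = 0 → ∃ k : ℤ, |y - k * Real.pi| ≤ D := by
    intro y hy h
    have h1 := Nat.floor_le (div_nonneg hy hpi.le)
    have h2 := Nat.lt_floor_add_one (y / Real.pi)
    rw [le_div_iff₀ hpi] at h1
    rw [div_lt_iff₀ hpi] at h2
    set m := ⌊y / Real.pi⌋₊
    by_contra! hcon
    have h3 := hcon m
    have h4 := hcon (m + 1)
    push_cast at h3 h4
    rw [abs_of_nonneg (by linarith)] at h3
    rw [abs_of_neg (by linarith)] at h4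
    have := neg_one_pow_mul_cosTransform_pos (l := y) ha hD m (by linarith) (by linarith)
    rw [h, mul_zero] at this
    exact lt_irrefl _ this
  rcases le_total 0 x with h | h
  · exact key x h hx
  · obtain ⟨k, hk⟩ := key (-x) (by linarith) (by rwa [cosTransform_neg])
    refine ⟨-k, ?_⟩
    rw [← abs_neg]
    push_cast
    convert hk using 2
    ring

/-- The transform has opposite signs at the two ends of the interval around a nonzero multiple of
`π`. Around `0` no sign change is available; there the factor `x` supplies the zero. -/
theorem exists_cosTransform_eq_zero_near {a D : ℝ} (ha : |a| < 1 / 2)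
    (hD : |a| * (Real.pi / 2) < D) (hD' : D < Real.pi / 4) {k : ℤ} (hk : k ≠ 0) :
    ∃ x, |x - k * Real.pi| ≤ D ∧ cosTransform a x = 0 := by
  have hpi := Real.pi_pos
  have hD0 : 0 < D := lt_of_le_of_lt (by positivity) hD
  have hcont : Continuous (cosTransform a) := continuous_cosTransform (by linarith [(abs_lt.mp ha).1])
  have key : ∀ m : ℕ, ∃ x, |x - (m + 1) * Real.pi| ≤ D ∧ cosTransform a x = 0 := by
    intro m
    have h1 := neg_one_pow_mul_cosTransform_pos (l := (m + 1) * Real.pi - D) ha hD m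
      (by linarith) le_rfl
    have h2 := neg_one_pow_mul_cosTransform_pos (l := (m + 1) * Real.pi + D) ha hD (m + 1)
      (by push_cast; linarith) (by push_cast; linarith)
    rw [pow_succ, mul_neg_one, neg_mul] at h2
    have h3 := intermediate_value_Icc' (f := fun x => (-1) ^ m * cosTransform a x)
      (show (m + 1) * Real.pi - D ≤ (m + 1) * Real.pi + D by linarith)
      (hcont.const_mul _).continuousOn
    obtain ⟨x, hx, hx0⟩ := h3 (⟨by linarith, h1.le⟩ : (0 : ℝ) ∈ Set.Icc _ _)
    refine ⟨x, abs_le.mpr ⟨by linarith [hx.1], by linarith [hx.2]⟩, ?_⟩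
    simpa using hx0
  obtain ⟨m, rfl | rfl⟩ := Int.eq_nat_or_neg k
  · obtain ⟨n, rfl⟩ := Nat.exists_eq_succ_of_ne_zero (show m ≠ 0 by simpa using hk)
    simpa using key n
  · obtain ⟨n, rfl⟩ := Nat.exists_eq_succ_of_ne_zero (show m ≠ 0 by simpa using hk)
    obtain ⟨x, hx, hx0⟩ := key n
    refine ⟨-x, ?_, by rwa [cosTransform_neg]⟩
    rw [← abs_neg]
    push_cast
    convert hx using 2
    ring

end Zeros

/-! ### The dual functions and their Fourier transforms. -/

section Dual

local notation "μI" => (volume.restrict (Set.Icc (0 : ℝ) 1) : Measure ℝ)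

/-- The Fourier transform of the weight `(u - u²)^a` on `[0,1]`. -/
noncomputable def weightFourier (a l : ℝ) : ℂ :=
  ∫ u in (0 : ℝ)..1, Complex.exp (-(2 * Complex.I * (l : ℂ) * (u : ℂ))) * (((u - u ^ 2) ^ a : ℝ) : ℂ)

/-- Centring at `u = 1/2` extracts the phase, and the symmetry `u ↦ 1 - u` of the weight kills the
sine part. -/
theorem weightFourier_eq {a : ℝ} (ha : -1 < a) (l : ℝ) :
    weightFourier a l = Complex.exp (-(Complex.I * l)) * cosTransform a l := by
  have hsin : ∫ u in (0 : ℝ)..1, Real.sin (l * (1 - 2 * u)) * (u - u ^ 2) ^ a = 0 := by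
    have h := intervalIntegral.integral_comp_sub_left (a := 0) (b := 1)
      (fun u : ℝ => Real.sin (l * (1 - 2 * u)) * (u - u ^ 2) ^ a) 1
    rw [sub_self, sub_zero] at h
    have h2 : ∀ u : ℝ, Real.sin (l * (1 - 2 * (1 - u))) * (1 - u - (1 - u) ^ 2) ^ a =
        -(Real.sin (l * (1 - 2 * u)) * (u - u ^ 2) ^ a) := by
      intro u
      rw [show l * (1 - 2 * (1 - u)) = -(l * (1 - 2 * u)) by ring, Real.sin_neg,
        show 1 - u - (1 - u) ^ 2 = u - u ^ 2 by ring, neg_mul]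
    simp_rw [h2] at h
    rw [intervalIntegral.integral_neg] at h
    linarith
  have hci := intervalIntegrable_mul_weight ha (p := fun u => Real.cos (l * (1 - 2 * u)))
    (by fun_prop)
  have hsi := intervalIntegrable_mul_weight ha (p := fun u => Real.sin (l * (1 - 2 * u)))
    (by fun_prop)
  have hof : ∀ {f : ℝ → ℝ}, IntervalIntegrable f volume 0 1 →
      IntervalIntegrable (fun u => (f u : ℂ)) volume 0 1 := by
    intro f h
    rw [intervalIntegrable_iff] at h ⊢
    exact h.ofReal
  have h1 : ∀ u : ℝ, Complex.exp (-(2 * Complex.I * (l : ℂ) * (u : ℂ))) *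
      (((u - u ^ 2) ^ a : ℝ) : ℂ) = Complex.exp (-(Complex.I * l)) *
      (((Real.cos (l * (1 - 2 * u)) * (u - u ^ 2) ^ a : ℝ) : ℂ) +
        Complex.I * ((Real.sin (l * (1 - 2 * u)) * (u - u ^ 2) ^ a : ℝ) : ℂ)) := by
    intro u
    have h2 : -(2 * Complex.I * (l : ℂ) * (u : ℂ)) =
        -(Complex.I * l) + ((l * (1 - 2 * u) : ℝ) : ℂ) * Complex.I := by push_cast; ring
    rw [h2, Complex.exp_add, Complex.exp_mul_I, ← Complex.ofReal_cos, ← Complex.ofReal_sin]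
    push_cast
    ring
  simp_rw [weightFourier, h1]
  rw [intervalIntegral.integral_const_mul,
    intervalIntegral.integral_add (hof hci) ((hof hsi).const_mul _),
    intervalIntegral.integral_const_mul, intervalIntegral.integral_ofReal,
    intervalIntegral.integral_ofReal, hsin, cosTransform]
  simp

/-- The convolution `∫_0^s e^{2iω(s-u)} (u-u²)^a du`. -/
noncomputable def expConv (a ω s : ℝ) : ℂ :=
  ∫ u in (0 : ℝ)..s, Complex.exp (2 * Complex.I * (ω : ℂ) * ((s - u : ℝ) : ℂ)) *
    (((u - u ^ 2) ^ a : ℝ) : ℂ)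

/-- The derivative of `expConv` on `(0,1)`, extended by zero. -/
noncomputable def derivExpConv (a ω : ℝ) : ℝ → ℂ :=
  (Set.Ioo (0 : ℝ) 1).indicator (deriv (expConv a ω))

theorem expConv_eq (a ω s : ℝ) :
    expConv a ω s = Complex.exp (2 * Complex.I * ω * s) *
      ∫ u in (0 : ℝ)..s, Complex.exp (-(2 * Complex.I * (ω : ℂ) * (u : ℂ))) *
        (((u - u ^ 2) ^ a : ℝ) : ℂ) := by
  rw [expConv, ← intervalIntegral.integral_const_mul]
  refine intervalIntegral.integral_congr fun u _ => ?_
  rw [← mul_assoc, ← Complex.exp_add]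
  congr 2
  push_cast
  ring

theorem intervalIntegrable_exp_mul_weight {a : ℝ} (ha : -1 < a) (l : ℝ) :
    IntervalIntegrable (fun u : ℝ => Complex.exp (-(2 * Complex.I * (l : ℂ) * (u : ℂ))) *
        (((u - u ^ 2) ^ a : ℝ) : ℂ)) volume 0 1 :=
  (intervalIntegrable_ofReal_weight ha).continuousOn_mul (by fun_prop)

theorem continuousOn_expConv {a : ℝ} (ha : -1 < a) (ω : ℝ) :
    ContinuousOn (expConv a ω) (Set.Icc 0 1) := by
  have h := intervalIntegrable_exp_mul_weight ha ω
  rw [intervalIntegrable_iff, Set.uIoc_of_le zero_le_one, ← integrableOn_Icc_iff_integrableOn_Ioc] at h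
  have h1 := intervalIntegral.continuousOn_primitive_interval (a := 0) (b := 1) (μ := volume)
    (by rwa [Set.uIcc_of_le zero_le_one])
  rw [Set.uIcc_of_le zero_le_one] at h1
  refine ContinuousOn.congr ?_ fun s _ => expConv_eq a ω s
  exact ContinuousOn.mul (by fun_prop) h1

theorem hasDerivAt_expConv {a : ℝ} (ha : -1 < a) (ω : ℝ) {s : ℝ} (hs : s ∈ Set.Ioo (0 : ℝ) 1) :
    HasDerivAt (expConv a ω)
      (2 * Complex.I * ω * expConv a ω s + (((s - s ^ 2) ^ a : ℝ) : ℂ)) s := by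
  have hcont : ContinuousOn (fun u : ℝ => Complex.exp (-(2 * Complex.I * (ω : ℂ) * (u : ℂ))) *
        (((u - u ^ 2) ^ a : ℝ) : ℂ)) (Set.Ioo 0 1) := by
    refine ContinuousOn.mul (by fun_prop) ?_
    refine Complex.continuous_ofReal.comp_continuousOn ?_
    exact ContinuousOn.rpow_const (by fun_prop) fun u hu => Or.inl (sub_sq_pos hu).ne'
  have h1 := intervalIntegral.integral_hasDerivAt_right
    ((intervalIntegrable_exp_mul_weight ha ω).mono_set
      (by rw [Set.uIcc_of_le hs.1.le, Set.uIcc_of_le zero_le_one]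
          exact Set.Icc_subset_Icc_right hs.2.le))
    (hcont.stronglyMeasurableAtFilter isOpen_Ioo s hs)
    (hcont.continuousAt (isOpen_Ioo.mem_nhds hs))
  have h2 : HasDerivAt (fun s : ℝ => Complex.exp (2 * Complex.I * ω * s))
      (Complex.exp (2 * Complex.I * ω * s) * (2 * Complex.I * ω)) s := by
    have h3 : HasDerivAt (fun s : ℝ => 2 * Complex.I * ω * (s : ℂ)) (2 * Complex.I * ω) s := by
      simpa using (Complex.ofRealCLM.hasDerivAt (x := s)).const_mul (2 * Complex.I * (ω : ℂ))
    exact h3.cexp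
  have h4 : expConv a ω = fun s : ℝ => Complex.exp (2 * Complex.I * ω * s) *
      ∫ u in (0 : ℝ)..s, Complex.exp (-(2 * Complex.I * (ω : ℂ) * (u : ℂ))) *
        (((u - u ^ 2) ^ a : ℝ) : ℂ) := funext fun s => expConv_eq a ω s
  rw [h4]
  refine (h2.mul h1).congr_deriv ?_
  simp only
  have h5 : Complex.exp (2 * Complex.I * ω * s) *
      Complex.exp (-(2 * Complex.I * (ω : ℂ) * (s : ℂ))) = 1 := by
    rw [← Complex.exp_add]; simp
  linear_combination (((s - s ^ 2) ^ a : ℝ) : ℂ) * h5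

theorem derivExpConv_eq {a : ℝ} (ha : -1 < a) (ω : ℝ) {s : ℝ} (hs : s ∈ Set.Ioo (0 : ℝ) 1) :
    derivExpConv a ω s = 2 * Complex.I * ω * expConv a ω s + (((s - s ^ 2) ^ a : ℝ) : ℂ) := by
  rw [derivExpConv, Set.indicator_of_mem hs, (hasDerivAt_expConv ha ω hs).deriv]

theorem ae_Icc_mem_Ioo : ∀ᵐ u : ℝ ∂μI, u ∈ Set.Ioo (0 : ℝ) 1 := by
  rw [← Measure.restrict_congr_set (Ioo_ae_eq_Icc (μ := volume) (a := (0 : ℝ)) (b := 1))]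
  exact ae_restrict_mem measurableSet_Ioo

/-- By `derivExpConv_eq`, a bounded term plus the weight itself, which is square integrable because
`2a > -1`. -/
theorem memLp_derivExpConv {a : ℝ} (ha : -(1 / 2) < a) (ω : ℝ) : MemLp (derivExpConv a ω) 2 μI := by
  have ha1 : -1 < a := by linarith
  have h1 : MemLp (expConv a ω) 2 μI := by
    obtain ⟨C, hC⟩ := isCompact_Icc.exists_bound_of_continuousOn (continuousOn_expConv ha1 ω)
    refine MemLp.of_bound ((continuousOn_expConv ha1 ω).aestronglyMeasurable measurableSet_Icc) C ?_
    filter_upwards [ae_restrict_mem measurableSet_Icc] with u hu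
    exact hC u hu
  have hmeas : AEStronglyMeasurable (fun u : ℝ => (u - u ^ 2) ^ a) μI := by
    have := intervalIntegrable_weight ha1
    rw [intervalIntegrable_iff, Set.uIoc_of_le zero_le_one,
      ← integrableOn_Icc_iff_integrableOn_Ioc] at this
    exact this.aestronglyMeasurable
  have h2 : MemLp (fun u : ℝ => (u - u ^ 2) ^ a) 2 μI := by
    rw [memLp_two_iff_integrable_sq hmeas]
    have h3 := intervalIntegrable_weight (a := 2 * a) (by linarith)
    rw [intervalIntegrable_iff, Set.uIoc_of_le zero_le_one,
      ← integrableOn_Icc_iff_integrableOn_Ioc] at h3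
    refine Integrable.congr h3 ?_
    filter_upwards [ae_Icc_mem_Ioo] with u hu
    rw [mul_comm, Real.rpow_mul (sub_sq_pos hu).le, Real.rpow_two]
  refine ((h1.const_mul (2 * Complex.I * ω)).add h2.ofReal).ae_eq ?_
  filter_upwards [ae_Icc_mem_Ioo] with u hu
  exact (derivExpConv_eq ha1 ω hu).symm

theorem intervalIntegrable_derivExpConv {a : ℝ} (ha : -(1 / 2) < a) (ω : ℝ) :
    IntervalIntegrable (derivExpConv a ω) volume 0 1 := by
  have h := (memLp_derivExpConv ha ω).integrable (by norm_num)
  rw [intervalIntegrable_iff, Set.uIoc_of_le zero_le_one, ← integrableOn_Icc_iff_integrableOn_Ioc]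
  exact h

/-- The Fourier transform of `derivExpConv a ω`. -/
noncomputable def dualFourier (a ω l : ℝ) : ℂ :=
  ∫ s in (0 : ℝ)..1, Complex.exp (-(2 * Complex.I * (l : ℂ) * (s : ℂ))) * derivExpConv a ω s

theorem continuous_dualFourier {a : ℝ} (ha : -(1 / 2) < a) (ω : ℝ) :
    Continuous (dualFourier a ω) := by
  have hg := intervalIntegrable_derivExpConv ha ω
  refine intervalIntegral.continuous_of_dominated_interval
    (bound := fun s => ‖derivExpConv a ω s‖) ?_ ?_ hg.norm ?_
  · intro l
    exact (intervalIntegrable_iff.mp (hg.continuousOn_mul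
      (g := fun s : ℝ => Complex.exp (-(2 * Complex.I * (l : ℂ) * (s : ℂ))))
      (by fun_prop))).aestronglyMeasurable
  · refine fun l => ae_of_all _ fun s _ => ?_
    rw [norm_mul]
    refine mul_le_of_le_one_left (norm_nonneg _) (le_of_eq ?_)
    have : -(2 * Complex.I * (l : ℂ) * (s : ℂ)) = ((-(2 * l * s) : ℝ) : ℂ) * Complex.I := by
      push_cast; ring
    rw [this, Complex.norm_exp_ofReal_mul_I]
  · exact ae_of_all _ fun s _ => by fun_prop

/-- Let `G = expConv a ω`, with transform `A`. Then `ĝ = 2iωA + ŵ`, while integration by parts gives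
`2i(ω - l)A + ŵ = e^{-2il} G(1)`. Multiplying by `ω` kills the boundary term, since `ω G(1)` is a
multiple of `ω ŵ(ω) = 0`; eliminating `A` finishes. No division occurs, so `ω = 0` is included. -/
theorem sub_mul_dualFourier {a : ℝ} (ha : -(1 / 2) < a) {ω : ℝ}
    (hω : ω * cosTransform a ω = 0) (l : ℝ) :
    (l - ω) * dualFourier a ω l = l * weightFourier a l := by
  have ha1 : -1 < a := by linarith
  have hG := continuousOn_expConv ha1 ω
  have hGi : IntervalIntegrable (fun s : ℝ =>
      Complex.exp (-(2 * Complex.I * (l : ℂ) * (s : ℂ))) * expConv a ω s) volume 0 1 := by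
    refine ContinuousOn.intervalIntegrable ?_
    rw [Set.uIcc_of_le zero_le_one]
    exact ContinuousOn.mul (by fun_prop) hG
  have hw := intervalIntegrable_exp_mul_weight ha1 l
  set A : ℂ := ∫ s in (0 : ℝ)..1, Complex.exp (-(2 * Complex.I * (l : ℂ) * (s : ℂ))) * expConv a ω s
  have hB : dualFourier a ω l = 2 * Complex.I * ω * A + weightFourier a l := by
    rw [weightFourier, ← intervalIntegral.integral_const_mul,
      ← intervalIntegral.integral_add (hGi.const_mul _) hw, dualFourier]
    rw [intervalIntegral.integral_of_le zero_le_one, intervalIntegral.integral_of_le zero_le_one]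
    refine integral_congr_ae ?_
    filter_upwards [ae_Ioc_mem_Ioo] with s hs
    rw [derivExpConv_eq ha1 ω hs]
    ring
  have hd : ∀ s ∈ Set.Ioo (0 : ℝ) 1, HasDerivAt
      (fun s : ℝ => Complex.exp (-(2 * Complex.I * (l : ℂ) * (s : ℂ))) * expConv a ω s)
      (2 * Complex.I * (ω - l) *
        (Complex.exp (-(2 * Complex.I * (l : ℂ) * (s : ℂ))) * expConv a ω s) +
        Complex.exp (-(2 * Complex.I * (l : ℂ) * (s : ℂ))) * (((s - s ^ 2) ^ a : ℝ) : ℂ)) s := by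
    intro s hs
    have h3 : HasDerivAt (fun s : ℝ => -(2 * Complex.I * l * (s : ℂ))) (-(2 * Complex.I * l)) s := by
      refine ((Complex.ofRealCLM.hasDerivAt (x := s)).const_mul
        (2 * Complex.I * (l : ℂ))).fun_neg.congr_deriv ?_
      simp
    refine (h3.cexp.mul (hasDerivAt_expConv ha1 ω hs)).congr_deriv ?_
    ring
  have hint := intervalIntegral.integral_eq_sub_of_hasDerivAt_of_le zero_le_one
    (f := fun s : ℝ => Complex.exp (-(2 * Complex.I * (l : ℂ) * (s : ℂ))) * expConv a ω s)
    (ContinuousOn.mul (by fun_prop) hG) hd ((hGi.const_mul _).add hw)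
  rw [intervalIntegral.integral_add (hGi.const_mul _) hw,
    intervalIntegral.integral_const_mul] at hint
  have h0 : expConv a ω 0 = 0 := by simp [expConv]
  have h1 : expConv a ω 1 = Complex.exp (2 * Complex.I * ω) * weightFourier a ω := by
    rw [expConv_eq, weightFourier]; simp
  have h2 : (ω : ℂ) * weightFourier a ω = 0 := by
    rw [weightFourier_eq ha1]
    have : (ω : ℂ) * cosTransform a ω = 0 := by exact_mod_cast hω
    linear_combination Complex.exp (-(Complex.I * ω)) * this
  rw [h0, h1] at hint
  change _ + weightFourier a l = _ at hint
  rw [hB]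
  linear_combination (-(ω : ℂ)) * hint - Complex.exp (-(2 * Complex.I * l * ((1 : ℝ) : ℂ))) *
    Complex.exp (2 * Complex.I * ω) * h2

theorem inner_exp_toLp {x : ℝ}
    (hf : MemLp (fun t : ℝ => Complex.exp (2 * Complex.I * (x : ℂ) * (t : ℂ))) 2 μI) {g : ℝ → ℂ}
    (hg : MemLp g 2 μI) :
    inner ℂ hf.toLp hg.toLp =
      ∫ s in (0 : ℝ)..1, Complex.exp (-(2 * Complex.I * (x : ℂ) * (s : ℂ))) * g s := by
  rw [L2.inner_def, ← integral_Icc_eq_intervalIntegral]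
  refine integral_congr_ae ?_
  filter_upwards [hf.coeFn_toLp, hg.coeFn_toLp] with t h1 h2
  rw [h1, h2, RCLike.inner_apply, ← Complex.exp_conj, mul_comm]
  congr 2
  simp [Complex.conj_ofNat]

theorem memLp_exp (x : ℝ) :
    MemLp (fun t : ℝ => Complex.exp (2 * Complex.I * (x : ℂ) * (t : ℂ))) 2 μI := by
  refine MemLp.of_bound (by fun_prop) 1 (ae_of_all _ fun t => ?_)
  have : (2 * Complex.I * (x : ℂ) * (t : ℂ)) = ((2 * x * t : ℝ) : ℂ) * Complex.I := by
    push_cast; ring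
  rw [this, Complex.norm_exp_ofReal_mul_I]

/-- Completeness of the exponentials prevents the dual function from being orthogonal to all of
them. -/
theorem exists_dualFourier_ne_zero {a D ω : ℝ} (ha : |a| < 1 / 2) (hD : |a| * (Real.pi / 2) < D)
    (hD' : D < Real.pi / 4) (hω : ω * cosTransform a ω = 0) {z : ℤ → ℝ}
    (hz : ∀ k : ℤ, |z k - k * Real.pi| ≤ D) : ∃ k, dualFourier a ω (z k) ≠ 0 := by
  have hpi := Real.pi_pos
  have ha' : -(1 / 2) < a := (abs_lt.mp ha).1
  by_contra! hcon
  have hg := memLp_derivExpConv ha' ω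
  have h0 : hg.toLp = 0 :=
    (isRieszBasis_exp_of_abs_sub_le hD' hz fun k => memLp_exp (z k)).eq_zero_of_inner_eq_zero
      fun k => by rw [inner_exp_toLp]; exact hcon k
  have h1 : ∀ l, dualFourier a ω l = 0 := by
    intro l
    have h := inner_exp_toLp (memLp_exp l) hg
    rw [h0, inner_zero_right] at h
    exact h.symm
  -- The point `π/2` is outside the neighbourhoods of `0` and `π`, so `l ŵ(l)` is nonzero there.
  have h2 := neg_one_pow_mul_cosTransform_pos (l := Real.pi / 2) ha hD 0
    (by push_cast; linarith) (by push_cast; linarith)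
  have h3 := sub_mul_dualFourier ha' hω (Real.pi / 2)
  rw [h1, mul_zero, weightFourier_eq (by linarith)] at h3
  have h4 : ((Real.pi / 2 : ℝ) : ℂ) ≠ 0 := by
    rw [Complex.ofReal_ne_zero]; positivity
  have h5 : ((cosTransform a (Real.pi / 2) : ℝ) : ℂ) ≠ 0 := by
    rw [Complex.ofReal_ne_zero]
    simpa using h2.ne'
  exact mul_ne_zero h4 (mul_ne_zero (Complex.exp_ne_zero _) h5) h3.symm

theorem dualFourier_eq_zero {a : ℝ} (ha : -(1 / 2) < a) {ω l : ℝ}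
    (hω : ω * cosTransform a ω = 0) (hl : l * cosTransform a l = 0) (hne : l ≠ ω) :
    dualFourier a ω l = 0 := by
  have h := sub_mul_dualFourier ha hω l
  have h2 : (l : ℂ) * weightFourier a l = 0 := by
    rw [weightFourier_eq (by linarith)]
    have : (l : ℂ) * cosTransform a l = 0 := by exact_mod_cast hl
    linear_combination Complex.exp (-(Complex.I * l)) * this
  rw [h2] at h
  exact (mul_eq_zero.mp h).resolve_left (sub_ne_zero.mpr (by exact_mod_cast hne))

/-! ### Uniqueness and enumeration of the zeros. -/

theorem eq_of_abs_sub_int_mul_pi_le {D x : ℝ} (hD : D < Real.pi / 4) {j k : ℤ}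
    (hj : |x - j * Real.pi| ≤ D) (hk : |x - k * Real.pi| ≤ D) : j = k := by
  have hpi := Real.pi_pos
  rw [abs_le] at hj hk
  have key : ∀ {i l : ℤ}, |x - i * Real.pi| ≤ D → |x - l * Real.pi| ≤ D → i ≤ l := by
    intro i l hi hl
    by_contra! h
    have h1 : (l + 1 : ℝ) ≤ i := by exact_mod_cast h
    rw [abs_le] at hi hl
    nlinarith
  exact le_antisymm (key (abs_le.mpr hj) (abs_le.mpr hk)) (key (abs_le.mpr hk) (abs_le.mpr hj))

theorem exists_zero_near {a D : ℝ} (ha : |a| < 1 / 2) (hD : |a| * (Real.pi / 2) < D)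
    (hD' : D < Real.pi / 4) (k : ℤ) : ∃ x, |x - k * Real.pi| ≤ D ∧ x * cosTransform a x = 0 := by
  rcases eq_or_ne k 0 with rfl | hk
  · refine ⟨0, ?_, zero_mul _⟩
    simpa using (lt_of_le_of_lt (by have := Real.pi_pos; positivity) hD).le
  · obtain ⟨x, hx, h⟩ := exists_cosTransform_eq_zero_near ha hD hD' hk
    exact ⟨x, hx, by rw [h, mul_zero]⟩

theorem exists_int_near_of_zero {a D x : ℝ} (ha : |a| < 1 / 2) (hD : |a| * (Real.pi / 2) < D)
    (hx : x * cosTransform a x = 0) : ∃ k : ℤ, |x - k * Real.pi| ≤ D := by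
  rcases mul_eq_zero.mp hx with rfl | h
  · refine ⟨0, ?_⟩
    simpa using (lt_of_le_of_lt (by have := Real.pi_pos; positivity) hD).le
  · exact exists_int_near_of_cosTransform_eq_zero ha hD h

/-- Each of the intervals around the multiples of `π` contains at most one zero: otherwise the
dual function of one zero would be orthogonal to a Riesz basis of exponentials through the other. -/
theorem zero_unique_near {a D x y : ℝ} (ha : |a| < 1 / 2) (hD : |a| * (Real.pi / 2) < D)
    (hD' : D < Real.pi / 4) {k : ℤ} (hx : x * cosTransform a x = 0)
    (hy : y * cosTransform a y = 0) (hxk : |x - k * Real.pi| ≤ D) (hyk : |y - k * Real.pi| ≤ D) :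
    x = y := by
  by_contra hne
  choose z hz hz0 using exists_zero_near ha hD hD'
  -- Replacing the `k`-th frequency by `y` keeps the sequence within Kadec's range and makes all its
  -- members zeros different from `x`.
  obtain ⟨j, hj⟩ := exists_dualFourier_ne_zero ha hD hD' hx (z := Function.update z k y)
    (fun i => by
      rcases eq_or_ne i k with rfl | hi
      · rwa [Function.update_self]
      · rw [Function.update_of_ne hi]; exact hz i)
  refine hj (dualFourier_eq_zero (abs_lt.mp ha).1 hx ?_ ?_)
  · rcases eq_or_ne j k with rfl | hi
    · rwa [Function.update_self]
    · rw [Function.update_of_ne hi]; exact hz0 j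
  · rcases eq_or_ne j k with rfl | hi
    · rw [Function.update_self]; exact Ne.symm hne
    · rw [Function.update_of_ne hi]
      intro h
      exact hi (eq_of_abs_sub_int_mul_pi_le hD' (hz j) (h ▸ hxk))

/-- Two enumerations differ by an order automorphism of `ℤ`, which commutes with successor and
predecessor; fixing `0`, it is the identity. -/
theorem IsOrderedZeros.unique {ν : ℝ} {ω ω' : ℤ → ℝ} (h : IsOrderedZeros ν ω)
    (h' : IsOrderedZeros ν ω') : ω = ω' := by
  let e : ℤ ≃o ℤ := (h.1.orderIso ω).trans
    ((OrderIso.setCongr _ _ (h.2.2.trans h'.2.2.symm)).trans (h'.1.orderIso ω').symm)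
  have he : ∀ k, ω' (e k) = ω k := by
    intro k
    have h1 : h'.1.orderIso ω' (e k) =
        OrderIso.setCongr _ _ (h.2.2.trans h'.2.2.symm) (h.1.orderIso ω k) :=
      (h'.1.orderIso ω').apply_symm_apply _
    exact congrArg Subtype.val h1
  have he0 : e 0 = 0 := h'.1.injective (by rw [he, h.2.1, h'.2.1])
  have heid : ∀ k, e k = k := by
    intro k
    induction k using Int.induction_on with
    | zero => exact he0
    | succ i ih =>
      have := e.map_succ (i : ℤ)
      rw [Order.succ_eq_add_one, ih] at this
      exact this
    | pred i ih =>
      have := e.map_pred (-i : ℤ)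
      rw [Order.pred_eq_sub_one, ih] at this
      exact this
  funext k
  rw [← he, heid]

theorem isOrderedZeros_besselZero {H D : ℝ} (hH : H ∈ Set.Ioo (0 : ℝ) 1)
    (hD : |1 / 2 - H| * (Real.pi / 2) < D) (hD' : D < Real.pi / 4) :
    IsOrderedZeros (1 - H) (besselZero H) ∧ ∀ k : ℤ, |besselZero H k - k * Real.pi| ≤ D := by
  have hpi := Real.pi_pos
  have ha : |1 / 2 - H| < 1 / 2 := abs_lt.mpr ⟨by linarith [hH.2], by linarith [hH.1]⟩
  choose z hz hz0 using exists_zero_near ha hD hD'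
  have hzo : IsOrderedZeros (1 - H) z := by
    refine ⟨strictMono_int_of_lt_succ fun k => ?_, ?_, ?_⟩
    · have h1 := abs_le.mp (hz k)
      have h2 := abs_le.mp (hz (k + 1))
      push_cast at h2
      linarith [h1.2, h2.1]
    · refine zero_unique_near ha hD hD' (hz0 0) (zero_mul _) (hz 0) ?_
      simpa using (abs_nonneg _).trans (hz 0)
    · ext x
      rw [Set.mem_ofPred_eq, besselJ_ofReal_eq_zero_iff (by linarith [hH.2]),
        show 1 - H - 1 / 2 = 1 / 2 - H by ring, ← mul_eq_zero]
      constructor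
      · rintro ⟨k, rfl⟩
        exact hz0 k
      · intro hx
        obtain ⟨k, hk⟩ := exists_int_near_of_zero ha hD hx
        exact ⟨k, zero_unique_near ha hD hD' (hz0 k) hx (hz k) hk⟩
  -- The chosen enumeration has its defining property only because `z` witnesses existence;
  -- uniqueness then transfers the distance estimate.
  have hb : IsOrderedZeros (1 - H) (besselZero H) := Classical.epsilon_spec ⟨z, hzo⟩
  refine ⟨hb, fun k => ?_⟩
  rw [hb.unique hzo]
  exact hz k

/-! ### Normalising constants and the values `a_k`. -/

theorem cH_pos {H : ℝ} (hH : H ∈ Set.Ioo (0 : ℝ) 1) : 0 < cH H := by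
  have hpi := Real.pi_pos
  refine mul_pos (Real.sin_pos_of_pos_of_lt_pi (mul_pos hpi hH.1) ?_)
    (Real.Gamma_pos_of_pos (by linarith [hH.1]))
  nlinarith [hH.2]

theorem zeroFactor_pos {H : ℝ} (hH : H ∈ Set.Ioo (0 : ℝ) 1) (k : ℤ) : 0 < zeroFactor H k := by
  unfold zeroFactor
  split_ifs
  · have := Real.sqrt_pos.mpr (show 0 < 2 - 2 * H by linarith [hH.2])
    linarith
  · simp

theorem cH'_pos {H : ℝ} (hH : H ∈ Set.Ioo (0 : ℝ) 1) (k : ℤ) : 0 < cH' H k :=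
  div_pos (mul_pos (Real.Gamma_pos_of_pos (by linarith [hH.2])) (Real.sqrt_pos.mpr (cH_pos hH)))
    (zeroFactor_pos hH k)

/-- One factor `2^(H-1)` comes from `φ_k`, the other from `(x/2)^(1-H)`; together they cancel the
power of two in `poissonConst`, whose `√π` cancels as well. -/
theorem phi_const_eq {H : ℝ} (hH : H ∈ Set.Ioo (0 : ℝ) 1) (k : ℤ) :
    √(Real.pi / cH H) * 2 ^ (H - 1) * zeroFactor H k * (2 ^ (H - 1) / poissonConst (1 / 2 - H)) =
      (cH' H k)⁻¹ := by
  have hpi := Real.pi_pos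
  have hG := (Real.Gamma_pos_of_pos (show 0 < 3 / 2 - H by linarith [hH.2])).ne'
  have hc := (Real.sqrt_pos.mpr (cH_pos hH)).ne'
  have hp := (Real.sqrt_pos.mpr hpi).ne'
  have hz := (zeroFactor_pos hH k).ne'
  have h2 : (2 : ℝ) ^ (-1 - 2 * (1 / 2 - H)) = 2 ^ (H - 1) * 2 ^ (H - 1) := by
    rw [← Real.rpow_add two_pos]; ring_nf
  have h3 : (2 : ℝ) ^ (H - 1) ≠ 0 := by positivity
  rw [cH', poissonConst, h2, show 1 / 2 - H + 1 = 3 / 2 - H by ring, Real.sqrt_div hpi.le]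
  field_simp

theorem phiOff_eq {H : ℝ} (hH : H ∈ Set.Ioo (0 : ℝ) 1) (k : ℤ)
    (hk : besselZero H k * cosTransform (1 / 2 - H) (besselZero H k) = 0) {x : ℝ}
    (hx : x ≠ besselZero H k) :
    phiOff H k x = ((cH' H k)⁻¹ : ℝ) * Complex.exp (Complex.I * besselZero H k) *
      dualFourier (1 / 2 - H) (besselZero H k) x := by
  have ha : -(1 / 2) < 1 / 2 - H := by linarith [hH.2]
  have h1 := sub_mul_dualFourier ha hk x
  rw [weightFourier_eq (by linarith)] at h1
  have hx' : (x : ℂ) - besselZero H k ≠ 0 := by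
    rw [sub_ne_zero]; exact_mod_cast hx
  have h2 : Complex.exp (Complex.I * ((besselZero H k - x : ℝ) : ℂ)) =
      Complex.exp (Complex.I * besselZero H k) * Complex.exp (-(Complex.I * x)) := by
    rw [← Complex.exp_add]
    push_cast
    ring_nf
  rw [phiOff, cpow_mul_besselJ hH, ← phi_const_eq hH k, h2, Complex.ofReal_sub, ← mul_div_assoc,
    div_eq_iff hx']
  push_cast
  linear_combination (-(√(Real.pi / cH H) : ℝ) * ((2 ^ (H - 1) : ℝ) : ℂ) * zeroFactor H k *
    (((2 ^ (H - 1) : ℝ) : ℂ) / poissonConst (1 / 2 - H)) *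
    Complex.exp (Complex.I * besselZero H k)) * h1

/-- By `phiOff_eq`, `φ_k` agrees off the removable point with a multiple of the continuous
`dualFourier`, whose value there is thus the limit. -/
theorem aCoeff_eq {H : ℝ} (hH : H ∈ Set.Ioo (0 : ℝ) 1) (k : ℤ)
    (hk : besselZero H k * cosTransform (1 / 2 - H) (besselZero H k) = 0) :
    aCoeff H k = (((cH' H k)⁻¹ : ℝ) * Complex.exp (Complex.I * besselZero H k) *
      dualFourier (1 / 2 - H) (besselZero H k) (besselZero H k))⁻¹ := by
  rw [aCoeff, phi, if_pos rfl]
  congr 1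
  refine Tendsto.limUnder_eq ?_
  have hcont : Continuous fun z : ℝ => ((cH' H k)⁻¹ : ℝ) *
      Complex.exp (Complex.I * besselZero H k) *
      dualFourier (1 / 2 - H) (besselZero H k) (z / 2) :=
    continuous_const.mul ((continuous_dualFourier (by linarith [hH.2]) _).comp (by fun_prop))
  have h1 := (hcont.tendsto (2 * besselZero H k)).mono_left
    (nhdsWithin_le_nhds (s := {2 * besselZero H k}ᶜ))
  rw [mul_div_cancel_left₀ _ two_ne_zero] at h1
  refine h1.congr' ?_
  filter_upwards [self_mem_nhdsWithin] with z hz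
  refine (phiOff_eq hH k hk ?_).symm
  intro h
  exact hz (by rw [Set.mem_singleton_iff]; linarith)

end Dual

theorem lemma4 (H : ℝ) (hH : H ∈ Set.Ioo (0 : ℝ) 1) :
    ∃ (hf : ∀ k : ℤ, MemLp (fFun H k) 2 (volume.restrict (Set.Icc (0 : ℝ) 1)))
      (hg : ∀ k : ℤ, MemLp (dualFun H k) 2 (volume.restrict (Set.Icc (0 : ℝ) 1))),
      IsRieszBasis (fun k : ℤ => (hf k).toLp (fFun H k)) ∧
      IsRieszBasis (fun k : ℤ => (hg k).toLp (dualFun H k)) ∧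
      IsBiorthogonal (fun k : ℤ => (hf k).toLp (fFun H k))
        (fun k : ℤ => (hg k).toLp (dualFun H k)) := by
  have hpi := Real.pi_pos
  have ha : |1 / 2 - H| < 1 / 2 := abs_lt.mpr ⟨by linarith [hH.2], by linarith [hH.1]⟩
  have ha' : -(1 / 2) < 1 / 2 - H := (abs_lt.mp ha).1
  obtain ⟨D, hD, hD'⟩ := exists_between
    (show |1 / 2 - H| * (Real.pi / 2) < Real.pi / 4 by nlinarith)
  obtain ⟨hord, hnear⟩ := isOrderedZeros_besselZero hH hD hD'
  have hzero : ∀ k, besselZero H k * cosTransform (1 / 2 - H) (besselZero H k) = 0 := by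
    intro k
    have h1 : besselZero H k ∈ {x : ℝ | besselJ ((1 - H : ℝ) : ℂ) x = 0} := hord.2.2 ▸ ⟨k, rfl⟩
    rw [Set.mem_ofPred_eq, besselJ_ofReal_eq_zero_iff (by linarith [hH.2]),
        show 1 - H - 1 / 2 = 1 / 2 - H by ring, ← mul_eq_zero] at h1
    exact h1
  have hf : ∀ k : ℤ, MemLp (fFun H k) 2 (volume.restrict (Set.Icc (0 : ℝ) 1)) := fun k => memLp_exp (besselZero H k)
  have hdual : ∀ k, dualFun H k = fun s =>
      (aCoeff H k * Complex.exp (Complex.I * (besselZero H k : ℂ)) / (cH' H k : ℂ)) *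
        derivExpConv (1 / 2 - H) (besselZero H k) s := by
    intro k
    funext s
    change aCoeff H k * Complex.exp (Complex.I * (besselZero H k : ℂ)) *
      derivExpConv (1 / 2 - H) (besselZero H k) s / (cH' H k : ℂ) = _
    ring
  have hg : ∀ k : ℤ, MemLp (dualFun H k) 2 (volume.restrict (Set.Icc (0 : ℝ) 1)) := by
    intro k
    rw [hdual]
    exact (memLp_derivExpConv ha' _).const_mul _
  have hR : IsRieszBasis fun k : ℤ => (hf k).toLp (fFun H k) :=
    isRieszBasis_exp_of_abs_sub_le hD' hnear hf
  have hB : IsBiorthogonal (fun k : ℤ => (hf k).toLp (fFun H k))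
      (fun k : ℤ => (hg k).toLp (dualFun H k)) := by
    intro i j
    have h1 : inner ℂ ((hf i).toLp (fFun H i)) ((hg j).toLp (dualFun H j)) =
        (aCoeff H j * Complex.exp (Complex.I * (besselZero H j : ℂ)) / (cH' H j : ℂ)) *
          dualFourier (1 / 2 - H) (besselZero H j) (besselZero H i) := by
      refine (inner_exp_toLp (hf i) (hg j)).trans ?_
      rw [dualFourier, ← intervalIntegral.integral_const_mul]
      refine intervalIntegral.integral_congr fun s _ => ?_
      simp only [hdual]
      ring
    rw [h1]
    split_ifs with hij
    · subst hij
      -- The transform is nonzero at some zero by completeness and vanishes at all those other than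
      -- its own.
      have h2 : dualFourier (1 / 2 - H) (besselZero H i) (besselZero H i) ≠ 0 := by
        obtain ⟨k, hk⟩ := exists_dualFourier_ne_zero ha hD hD' (hzero i) hnear
        rcases eq_or_ne k i with rfl | hki
        · exact hk
        · exact absurd (dualFourier_eq_zero ha' (hzero i) (hzero k)
            fun h => hki (hord.1.injective h)) hk
      have h3 : (cH' H i : ℂ) ≠ 0 := by exact_mod_cast (cH'_pos hH i).ne'
      have h4 := Complex.exp_ne_zero (Complex.I * (besselZero H i : ℂ))
      rw [aCoeff_eq hH i (hzero i)]
      generalize dualFourier (1 / 2 - H) (besselZero H i) (besselZero H i) = d at h2 ⊢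
      push_cast
      field_simp
    · rw [dualFourier_eq_zero ha' (hzero j) (hzero i) fun h => hij (hord.1.injective h), mul_zero]
  exact ⟨hf, hg, hR, hR.of_isBiorthogonal hB, hB⟩
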